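/- Let $\alpha\in[0,1)$ and $T_0=\frac{4}{2-\alpha}$. Let $A u=(x^\alpha u')'$ be the operator on $L^2(0,1)$ whose domain $D(A)$ consists of all $u\in L^2(0,1)$ that are absolutely continuous on $[0,1]$ with $x^{\alpha/2}u'\in L^2(0,1)$, $x^\alpha u'\in H^1(0,1)$, $(x^\alpha u')(0)=0$ and $u'(1)=0$. Let $0=\lambda_{\alpha,0}<\lambda_{\alpha,1}<\lambda_{\alpha,2}<\cdots$ be the eigenvalues of $-A$ in increasing order, and set $\omega_{\alpha,n}=\sqrt{\lambda_{\alpha,n}}$ for $n\ge 1$, $\omega_{\alpha,0}=0$, and $\omega_{\alpha,n}=-\sqrt{\lambda_{\alpha,|n|}}$ for $n\le -1$. Then the family $(e^{i\omega_{\alpha,n}t})_{n\in\mathbb Z}$ is a Riesz basis of the complex Hilbert space $L^2(0,T_0)$, that is, the image of an orthonormal basis under a bounded linear operator with bounded inverse. -/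

import Mathlib

open MeasureTheory Set

noncomputable section

namespace DegWave

/-- Lebesgue measure on the open interval `(a, b)`. -/
abbrev vol (a b : ℝ) : Measure ℝ := volume.restrict (Ioo a b)

/-- The weighted space `H¹_α(0,1)` for `α ∈ [0,1)`: functions `u ∈ L²(0,1)` that are absolutely
continuous on `[0,1]` and satisfy `x^{α/2} u_x ∈ L²(0,1)`. -/
structure MemH1 (α : ℝ) (u : ℝ → ℝ) : Prop where
  memLp : MemLp u 2 (vol 0 1)
  absCont : AbsolutelyContinuousOnInterval u 0 1
  memLp_deriv : MemLp (fun x => x ^ (α / 2) * deriv u x) 2 (vol 0 1)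

/-- `w` is the continuous representative on `[0,1]` of the function `x^α u_x`, and this function
belongs to the Sobolev space `H¹(0,1)`. -/
structure IsFlux (α : ℝ) (u w : ℝ → ℝ) : Prop where
  absCont : AbsolutelyContinuousOnInterval w 0 1
  ae_eq : w =ᵐ[vol 0 1] fun x => x ^ α * deriv u x
  memLp_deriv : MemLp (deriv w) 2 (vol 0 1)

/-- The graph of the operator `A u = (x^α u_x)_x` with domain
`D(A) = {u ∈ H²_α(0,1) : (x^α u_x)(0) = 0, u_x(1) = 0}`: `u ∈ D(A)` and `A u = f` in `L²(0,1)`.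
At `x = 1` the weight `x^α` is `1`, so that the value there of the continuous
representative `w` of `x^α u_x` is `u_x(1)`. -/
def GraphA (α : ℝ) (u f : ℝ → ℝ) : Prop :=
  MemH1 α u ∧ ∃ w : ℝ → ℝ, IsFlux α u w ∧ w 0 = 0 ∧ w 1 = 0 ∧ deriv w =ᵐ[vol 0 1] f

/-- The eigenvalues of `-A`: the real `l` for which there is `Φ ∈ D(A)`, not zero in `L²(0,1)`,
with `-A Φ = l Φ`, that is `-(x^α Φ')' = l Φ` on `(0,1)`, `(x^α Φ')(0) = 0`, `Φ'(1) = 0`. -/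
def eigenvalues (α : ℝ) : Set ℝ :=
  {l | ∃ Φ : ℝ → ℝ, (¬ Φ =ᵐ[vol 0 1] 0) ∧ GraphA α Φ (fun x => -(l * Φ x))}

/-- The increasing enumeration `s₀ < s₁ < s₂ < …` of a set of reals that is infinite, bounded below
and has no finite accumulation point. -/
def incEnum (S : Set ℝ) : ℕ → ℝ
  | 0 => sInf S
  | n + 1 => sInf {x | x ∈ S ∧ incEnum S n < x}

/-- `λ_{α,n}`, `n = 0, 1, 2, …`: the eigenvalues of `-A` in increasing order. -/
def lam (α : ℝ) (n : ℕ) : ℝ := incEnum (eigenvalues α) n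

/-- `ω_{α,n} = √λ_{α,n}` for `n ≥ 1`, `ω_{α,0} = 0`, `ω_{α,n} = -√λ_{α,|n|}` for `n ≤ -1`. -/
def omega (α : ℝ) (n : ℤ) : ℝ :=
  if n < 0 then -√(lam α n.natAbs) else if n = 0 then 0 else √(lam α n.natAbs)

/-- The threshold time `T₀ = 4 / (2 - α)`. -/
def T0 (α : ℝ) : ℝ := 4 / (2 - α)

theorem memLp_exp (T w : ℝ) :
    MemLp (fun t : ℝ => Complex.exp (Complex.I * w * t)) 2 (vol 0 T) := by
  refine MemLp.of_bound (Continuous.aestronglyMeasurable (by fun_prop)) 1 (ae_of_all _ fun t => ?_)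
  have h : Complex.I * w * t = ((w * t : ℝ) : ℂ) * Complex.I := by push_cast; ring
  rw [h, Complex.norm_exp_ofReal_mul_I]

/-- The exponential `t ↦ e^{i w t}` as an element of the complex space `L²(0,T)`. -/
def expL2 (T w : ℝ) : Lp ℂ 2 (vol 0 T) := (memLp_exp T w).toLp _

/-- A family in a Hilbert space is a Riesz basis if it is the image of an orthonormal (Hilbert)
basis under a bounded linear operator with bounded inverse. -/
def IsRieszBasis {ι H : Type*} [NormedAddCommGroup H] [InnerProductSpace ℂ H] (f : ι → H) : Prop :=
  ∃ (b : HilbertBasis ι ℂ H) (L : H ≃L[ℂ] H), ∀ i, f i = L (b i)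

end DegWave

end

/-!
The eigenvalue problem is solved by Bessel functions. With `p = α / (2(2 - α)) ∈ [0, 1/2)` and
`I(z) = ∫₀¹ cos (zt) (1 - t²)^p dt`, a constant multiple of `z^(-μ) J_μ(z)` for `μ = 1/(2 - α)`, the
solution of `(x^α u')' = -l u` with vanishing flux at `0` has flux proportional to
`x I(√l x^κ / κ)`, where `κ = (2 - α)/2`. A Wronskian argument shows that the positive eigenvalues
are the numbers `(κ z)²`, where `z` runs through the positive zeros of `I`
(`mem_eigenvalues_of_zero`, `zero_of_mem_eigenvalues`).

The zeros are located by moving the contour of the Poisson integral to the vertical half-lines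
above `0` and `1`. The first contributes nothing to the real part, and the second gives
`I(z) = ∫₀^∞ e^(-zy) Im (e^(iz) (y² - 2iy)^p) dy`. The argument of `y² - 2iy` lies between `-π/2`
and `0`, so the integrand keeps the sign `(-1)^n` for `πn + πp/2 < z < π(n + 1)`
(`poissonBessel_sign`). Hence every positive zero lies in some `[πn, πn + πp/2]` with `n ≥ 1`, each
of these intervals contains one by the intermediate value theorem, and only one by Sturm comparison
(`exists_zeros_poissonBessel`).

In terms of the frequencies, `|ω_n - 2πn/T₀| T₀ ≤ πp < π/2`, which is the hypothesis of Kadec's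
`1/4` theorem (`isRieszBasis_expL2`). It is proved as in Kadec's original argument: the quotient of
`e^(iω_n t)` by the exponential of frequency `2πn/T` is, up to a phase, `e^(iθ(1 - 2s))` with
`s = t/T` and `|θ| ≤ Θ < π/4`. Its cosine series on `[0, 1]` exhibits the perturbation of the
orthonormal basis as a sum of operators of norms adding up to at most `1 - cos Θ + sin Θ < 1`.
-/

/-! ### Small perturbations of a Hilbert basis -/

/-- A family `g` that satisfies a Bessel-type bound with constant `q` is the image of a Hilbert
basis under an operator of norm at most `q`. -/
theorem HilbertBasis.exists_clm_of_bound {ι H : Type*} [NormedAddCommGroup H]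
    [InnerProductSpace ℂ H] [CompleteSpace H] (b : HilbertBasis ι ℂ H) (g : ι → H) {q : ℝ}
    (hq : 0 ≤ q)
    (hg : ∀ (s : Finset ι) (a : ι → ℂ), ‖∑ n ∈ s, a n • g n‖ ≤ q * √(∑ n ∈ s, ‖a n‖ ^ 2)) :
    ∃ D : H →L[ℂ] H, (∀ n, D (b n) = g n) ∧ ‖D‖ ≤ q := by
  classical
  have hsq : ∀ x : H, HasSum (fun n => ‖b.repr x n‖ ^ 2) (‖x‖ ^ 2) := fun x => by
    have h := lp.hasSum_norm (p := 2) (by norm_num) (b.repr x)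
    simpa using h
  have hsum : ∀ x : H, Summable (fun n => b.repr x n • g n) := fun x => by
    rw [summable_iff_vanishing_norm]
    intro ε hε
    have h := summable_iff_vanishing_norm.1 (hsq x).summable ((ε / (q + 1)) ^ 2) (by positivity)
    obtain ⟨s, hs⟩ := h
    refine ⟨s, fun t ht => ?_⟩
    have h1 := hs t ht
    rw [Real.norm_of_nonneg (Finset.sum_nonneg fun _ _ => by positivity)] at h1
    have h2 : √(∑ n ∈ t, ‖b.repr x n‖ ^ 2) < ε / (q + 1) := by
      rw [Real.sqrt_lt' (by positivity)]; exact h1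
    calc _ ≤ q * √(∑ n ∈ t, ‖b.repr x n‖ ^ 2) := hg t _
      _ ≤ q * (ε / (q + 1)) := by gcongr
      _ < ε := by
        rw [mul_div_assoc', div_lt_iff₀ (by positivity)]
        linarith
  have hbd : ∀ x : H, ‖∑' n, b.repr x n • g n‖ ≤ q * ‖x‖ := fun x => by
    refine le_of_tendsto ((hsum x).hasSum.norm) (Filter.Eventually.of_forall fun s => ?_)
    refine (hg s _).trans ?_
    gcongr
    refine Real.sqrt_le_iff.2 ⟨norm_nonneg _, ?_⟩
    exact sum_le_hasSum s (fun _ _ => by positivity) (hsq x)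
  let D₀ : H →ₗ[ℂ] H :=
    { toFun := fun x => ∑' n, b.repr x n • g n
      map_add' := fun x y => by
        rw [← (hsum x).tsum_add (hsum y)]
        refine tsum_congr fun n => ?_
        simp [add_smul]
      map_smul' := fun c x => by
        rw [RingHom.id_apply, ← (hsum x).tsum_const_smul c]
        refine tsum_congr fun n => ?_
        simp [mul_smul] }
  refine ⟨D₀.mkContinuous q hbd, fun n => ?_, D₀.mkContinuous_norm_le hq hbd⟩
  change ∑' m, b.repr (b n) m • g m = g n
  rw [tsum_eq_single n]
  · rw [b.repr_self]
    simp [lp.single_apply]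
  · intro m hm
    rw [b.repr_self]
    simp [lp.single_apply, hm]

/-- **Paley–Wiener criterion**: a family which differs from a Hilbert basis by a perturbation with
Bessel-type bound `q < 1` is, up to scaling, a Riesz basis. -/
theorem DegWave.isRieszBasis_of_bound {ι H : Type*} [NormedAddCommGroup H]
    [InnerProductSpace ℂ H] [CompleteSpace H] (b : HilbertBasis ι ℂ H) (f g : ι → H) {q : ℝ}
    {c : ℂ} (hc : c ≠ 0) (hf : ∀ n, f n = c • (b n - g n)) (hq : 0 ≤ q) (hq1 : q < 1)
    (hg : ∀ (s : Finset ι) (a : ι → ℂ), ‖∑ n ∈ s, a n • g n‖ ≤ q * √(∑ n ∈ s, ‖a n‖ ^ 2)) :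
    DegWave.IsRieszBasis f := by
  obtain ⟨D, hD, hn⟩ := b.exists_clm_of_bound g hq hg
  refine ⟨b, (ContinuousLinearEquiv.unitsEquiv ℂ H (Units.oneSub D (hn.trans_lt hq1))).trans
    (ContinuousLinearEquiv.smulLeft (Units.mk0 c hc)), fun n => ?_⟩
  rw [hf, ← hD]
  rfl

/-- If `g n = ∑ₖ C k n • P k n` where every family `P k` is orthonormal and `|C k n| ≤ σ k`, then
`g` has Bessel-type bound `∑ₖ σ k`. -/
theorem norm_sum_smul_le_of_hasSum_orthonormal {ι κ H : Type*} [NormedAddCommGroup H]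
    [InnerProductSpace ℂ H] {g : ι → H} {P : κ → ι → H} {C : κ → ι → ℂ} {σ : κ → ℝ} {q : ℝ}
    (hP : ∀ k, Orthonormal ℂ (P k)) (hC : ∀ k n, ‖C k n‖ ≤ σ k) (hσ : HasSum σ q)
    (hg : ∀ n, HasSum (fun k => C k n • P k n) (g n)) (s : Finset ι) (a : ι → ℂ) :
    ‖∑ n ∈ s, a n • g n‖ ≤ q * √(∑ n ∈ s, ‖a n‖ ^ 2) := by
  have h1 : HasSum (fun k => ∑ n ∈ s, a n • (C k n • P k n)) (∑ n ∈ s, a n • g n) :=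
    hasSum_sum fun n _ => (hg n).const_smul (a n)
  refine h1.norm_le_of_bounded (hσ.mul_right _) fun k => ?_
  have h2 : ‖∑ n ∈ s, a n • (C k n • P k n)‖ ^ 2 = ∑ n ∈ s, ‖a n * C k n‖ ^ 2 := by
    simp_rw [smul_smul]
    rw [norm_sq_eq_re_inner (𝕜 := ℂ), (hP k).inner_sum]
    simp only [map_sum]
    refine Finset.sum_congr rfl fun n _ => ?_
    rw [RCLike.conj_mul]
    norm_cast
  have hσk : ∀ n ∈ s, 0 ≤ σ k := fun n _ => (norm_nonneg _).trans (hC k n)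
  rcases s.eq_empty_or_nonempty with rfl | ⟨n0, hn0⟩
  · simp
  have h0 := hσk n0 hn0
  refine abs_le_of_sq_le_sq' ?_ (by positivity) |>.2
  rw [h2, mul_pow, Real.sq_sqrt (Finset.sum_nonneg fun _ _ => by positivity), Finset.mul_sum]
  refine Finset.sum_le_sum fun n _ => ?_
  rw [norm_mul, mul_pow, mul_comm]
  gcongr
  exact hC k n

/-! ### Exponentials in `L²(0, T)` -/

namespace DegWave

theorem coeFn_expL2 (T w : ℝ) :
    expL2 T w =ᵐ[vol 0 T] fun t : ℝ => Complex.exp (Complex.I * w * t) :=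
  (memLp_exp T w).coeFn_toLp

theorem norm_exp_I_mul_mul (w t : ℝ) : ‖Complex.exp (Complex.I * w * t)‖ = 1 := by
  have h : Complex.I * w * t = ((w * t : ℝ) : ℂ) * Complex.I := by push_cast; ring
  rw [h, Complex.norm_exp_ofReal_mul_I]

theorem inner_expL2 {T : ℝ} (hT : 0 < T) (v w : ℝ) :
    inner ℂ (expL2 T v) (expL2 T w) =
      ∫ t in (0 : ℝ)..T, Complex.exp (Complex.I * (w - v : ℝ) * t) := by
  rw [L2.inner_def, intervalIntegral.integral_of_le hT.le, integral_Ioc_eq_integral_Ioo]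
  refine integral_congr_ae ?_
  filter_upwards [coeFn_expL2 T v, coeFn_expL2 T w] with t h1 h2
  rw [h1, h2, RCLike.inner_apply, ← Complex.exp_conj, ← Complex.exp_add]
  congr 1
  simp only [map_mul, Complex.conj_I, Complex.conj_ofReal]
  push_cast
  ring

theorem inner_expL2_self {T : ℝ} (hT : 0 < T) (w : ℝ) :
    inner ℂ (expL2 T w) (expL2 T w) = (T : ℂ) := by
  rw [inner_expL2 hT]
  simp

theorem inner_expL2_eq_zero {T : ℝ} (hT : 0 < T) {v w : ℝ} {j : ℤ} (hj : j ≠ 0)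
    (h : (w - v) * T = 2 * Real.pi * j) : inner ℂ (expL2 T v) (expL2 T w) = 0 := by
  rw [inner_expL2 hT]
  have hvw : w - v ≠ 0 := by
    intro h0
    rw [h0, zero_mul, eq_comm] at h
    simp [Real.pi_ne_zero, hj] at h
  have hc : Complex.I * (w - v : ℝ) ≠ 0 := by
    simpa [Complex.I_ne_zero] using Complex.ofReal_ne_zero.2 hvw
  rw [integral_exp_mul_complex hc]
  have : Complex.I * (w - v : ℝ) * (T : ℝ) = j * (2 * Real.pi * Complex.I) := by
    rw [mul_assoc, ← Complex.ofReal_mul, h]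
    push_cast
    ring
  rw [this, Complex.exp_int_mul_two_pi_mul_I]
  simp

/-- Exponentials whose frequencies differ by nonzero multiples of `2π/T`, with arbitrary phases,
are orthogonal on `(0, T)`. -/
theorem orthonormal_expL2 {ι : Type*} {T : ℝ} (hT : 0 < T) (u : ι → ℂ) (hu : ∀ n, ‖u n‖ = 1)
    (w : ι → ℝ) (hw : ∀ n m, n ≠ m → ∃ j : ℤ, j ≠ 0 ∧ (w m - w n) * T = 2 * Real.pi * j) :
    Orthonormal ℂ (fun n => (u n / (√T : ℝ)) • expL2 T (w n)) := by
  have hs : (√T : ℝ) ≠ 0 := by positivity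
  refine ⟨fun n => ?_, fun n m hnm => ?_⟩
  · have h2 : ‖expL2 T (w n)‖ = √T := by
      rw [norm_eq_sqrt_re_inner (𝕜 := ℂ), inner_expL2_self hT]
      simp
    rw [norm_smul, norm_div, hu, h2, Complex.norm_real, Real.norm_of_nonneg (Real.sqrt_nonneg _)]
    field_simp
  · obtain ⟨j, hj, h⟩ := hw n m hnm
    change inner ℂ (_ • _) (_ • _) = 0
    rw [inner_smul_left, inner_smul_right, inner_expL2_eq_zero hT hj h]
    simp

/-- The exponentials of frequencies `2πn/T`, with arbitrary phases, form a Hilbert basis of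
`L²(0, T)`. -/
theorem exists_hilbertBasis_expL2 {T : ℝ} (hT : 0 < T) (u : ℤ → ℂ) (hu : ∀ n, ‖u n‖ = 1) :
    ∃ b : HilbertBasis ℤ ℂ (Lp ℂ 2 (vol 0 T)),
      ∀ n, b n = (u n / (√T : ℝ)) • expL2 T (2 * Real.pi * n / T) := by
  have hon : Orthonormal ℂ (fun n : ℤ => (u n / (√T : ℝ)) • expL2 T (2 * Real.pi * n / T)) := by
    refine orthonormal_expL2 hT u hu _ fun n m hnm => ⟨m - n, sub_ne_zero.2 hnm.symm, ?_⟩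
    push_cast
    field_simp
  refine ⟨HilbertBasis.mkOfOrthogonalEqBot hon ?_,
    fun n => by rw [HilbertBasis.coe_mkOfOrthogonalEqBot]⟩
  rw [Submodule.eq_bot_iff]
  intro f hf
  have hf0 : ∀ n : ℤ, inner ℂ (expL2 T (2 * Real.pi * n / T)) f = 0 := fun n => by
    have h := (Submodule.mem_orthogonal _ _).1 hf _ (Submodule.subset_span ⟨n, rfl⟩)
    rw [inner_smul_left] at h
    refine (mul_eq_zero.1 h).resolve_left ?_
    have : u n ≠ 0 := fun h0 => by simpa [h0] using hu n
    simp [this, hT.le, hT.ne']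
  have hmem : MemLp f 2 (volume.restrict (Ioc 0 T)) := by
    rw [← restrict_Ioo_eq_restrict_Ioc]
    exact Lp.memLp f
  have hcoef : ∀ n : ℤ, fourierCoeffOn hT f n = 0 := fun n => by
    rw [fourierCoeffOn_eq_integral, intervalIntegral.integral_of_le hT.le,
      integral_Ioc_eq_integral_Ioo]
    have h := hf0 n
    rw [L2.inner_def] at h
    rw [smul_eq_zero]
    right
    rw [← h]
    refine integral_congr_ae ?_
    filter_upwards [coeFn_expL2 T (2 * Real.pi * n / T)] with t h1
    rw [h1, RCLike.inner_apply, fourier_coe_apply, ← Complex.exp_conj, smul_eq_mul, mul_comm]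
    congr 2
    simp only [map_mul, Complex.conj_I, Complex.conj_ofReal]
    push_cast
    rw [sub_zero]
    ring
  have hz := hasSum_sq_fourierCoeffOn hT hmem
  simp only [hcoef, norm_zero, ne_eq, OfNat.ofNat_ne_zero, not_false_eq_true, zero_pow] at hz
  have h0 := hz.unique hasSum_zero
  rw [smul_eq_mul, mul_eq_zero] at h0
  have h0 := h0.resolve_left (by simpa using hT.ne')
  rw [intervalIntegral.integral_of_le hT.le, integral_Ioc_eq_integral_Ioo] at h0
  have hint : Integrable (fun x => ‖f x‖ ^ 2) (vol 0 T) :=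
    (Lp.memLp f).integrable_norm_pow (by norm_num)
  rw [integral_eq_zero_iff_of_nonneg (fun _ => by positivity) hint] at h0
  refine (Lp.eq_zero_iff_ae_eq_zero).2 ?_
  filter_upwards [h0] with x hx
  simpa using hx

end DegWave

/-! ### Kadec's 1/4 theorem -/

namespace DegWave

open Complex in
/-- The Fourier coefficients of the `2`-periodic function equal to `exp (iθ(1 - 2|s|))` on
`[-1, 1]`. -/
noncomputable def kadecCoeff (θ : ℝ) (k : ℤ) : ℂ :=
  if k = 0 then (Real.sinc θ : ℂ)
  else if Even k then ((Real.sin θ * (4 * θ / (4 * θ ^ 2 - Real.pi ^ 2 * k ^ 2)) : ℝ) : ℂ)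
  else -I * ((Real.cos θ * (4 * θ / (4 * θ ^ 2 - Real.pi ^ 2 * k ^ 2)) : ℝ) : ℂ)

theorem kadec_denom_bound {θ : ℝ} (hθ : |θ| < Real.pi / 4) {k : ℤ} (hk : k ≠ 0) :
    3 * Real.pi ^ 2 / 4 * (k : ℝ) ^ 2 ≤ Real.pi ^ 2 * k ^ 2 - 4 * θ ^ 2 := by
  have h1 : (1 : ℝ) ≤ (k : ℝ) ^ 2 := by
    have : 1 ≤ k ^ 2 := by have := sq_pos_of_ne_zero hk; omega
    exact_mod_cast this
  have h2 : θ ^ 2 ≤ (Real.pi / 4) ^ 2 := sq_le_sq.2 (by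
    rw [abs_of_pos (show 0 < Real.pi / 4 by positivity)]; exact hθ.le)
  nlinarith [mul_le_mul_of_nonneg_left h1 (sq_nonneg Real.pi)]

theorem norm_kadecCoeff_le {θ : ℝ} (hθ : |θ| < Real.pi / 4) (k : ℤ) (hk : k ≠ 0) :
    ‖kadecCoeff θ k‖ ≤ 1 / (k : ℝ) ^ 2 := by
  have hd := kadec_denom_bound hθ hk
  have hk2 : 0 < (k : ℝ) ^ 2 := by positivity
  have hpi := Real.pi_gt_three
  have h1 : |4 * θ / (4 * θ ^ 2 - Real.pi ^ 2 * k ^ 2)| ≤ 1 / (k : ℝ) ^ 2 := by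
    have hneg : 4 * θ ^ 2 - Real.pi ^ 2 * k ^ 2 < 0 := by
      have : 0 < 3 * Real.pi ^ 2 / 4 * (k : ℝ) ^ 2 := by positivity
      linarith
    rw [abs_div, abs_of_neg hneg, div_le_div_iff₀ (by linarith) hk2, abs_mul, abs_of_pos four_pos]
    have : 4 * |θ| ≤ 3 * Real.pi ^ 2 / 4 := by nlinarith
    nlinarith
  unfold kadecCoeff
  rw [if_neg hk]
  split_ifs
  · rw [Complex.norm_real, Real.norm_eq_abs, abs_mul]
    exact (mul_le_of_le_one_left (abs_nonneg _) (Real.abs_sin_le_one θ)).trans h1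
  · rw [norm_mul, norm_neg, Complex.norm_I, one_mul, Complex.norm_real, Real.norm_eq_abs, abs_mul]
    exact (mul_le_of_le_one_left (abs_nonneg _) (Real.abs_cos_le_one θ)).trans h1

theorem summable_kadecCoeff {θ : ℝ} (hθ : |θ| < Real.pi / 4) : Summable (kadecCoeff θ) := by
  refine Summable.of_norm_bounded_eventually
    (Real.summable_one_div_int_pow (p := 2) |>.2 (by norm_num)) ?_
  filter_upwards [(Set.finite_singleton (0 : ℤ)).compl_mem_cofinite] with k hk
  exact norm_kadecCoeff_le hθ k hk

open Complex in
theorem fourierCoeffOn_exp_abs {θ : ℝ} (hθ : |θ| < Real.pi / 4) (h0 : θ ≠ 0)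
    {c : ℝ} (hc : c = 1) (h : (-1 : ℝ) < c) (k : ℤ) :
    fourierCoeffOn h (fun s : ℝ => exp (I * θ * (1 - 2 * |s| : ℝ))) k = kadecCoeff θ k := by
  subst hc
  have hA : (2 * θ + Real.pi * k : ℝ) ≠ 0 ∧ (2 * θ - Real.pi * k : ℝ) ≠ 0 := by
    by_cases hk : k = 0
    · simp [hk, h0]
    have hd := kadec_denom_bound hθ hk
    have : 0 < 3 * Real.pi ^ 2 / 4 * (k : ℝ) ^ 2 := by positivity
    have h3 : (2 * θ + Real.pi * k : ℝ) * (2 * θ - Real.pi * k : ℝ) ≠ 0 := by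
      ring_nf; intro h; nlinarith
    exact ⟨left_ne_zero_of_mul h3, right_ne_zero_of_mul h3⟩
  have hA1 : (2 * θ + Real.pi * k : ℂ) ≠ 0 := by exact_mod_cast Complex.ofReal_ne_zero.2 hA.1
  have hA2 : (2 * θ - Real.pi * k : ℂ) ≠ 0 := by exact_mod_cast Complex.ofReal_ne_zero.2 hA.2
  have hpart : ∀ c : ℂ, c ≠ 0 → ∫ x in (0 : ℝ)..1, exp (c * x) = (exp c - 1) / c := by
    intro c hc
    rw [integral_exp_mul_complex hc]
    simp
  -- the two halves of the integral are exponential integrals after the reflection `s ↦ -s`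
  have hR : ∫ s in (0 : ℝ)..1, exp (-(I * Real.pi * k * s)) * exp (I * θ * (1 - 2 * |s| : ℝ)) =
      exp (I * θ) * ((exp (-I * (2 * θ + Real.pi * k)) - 1) / (-I * (2 * θ + Real.pi * k))) := by
    rw [← hpart _ (mul_ne_zero (neg_ne_zero.2 I_ne_zero) hA1),
      ← intervalIntegral.integral_const_mul]
    refine intervalIntegral.integral_congr fun s hs => ?_
    rw [uIcc_of_le zero_le_one] at hs
    simp only [abs_of_nonneg hs.1]
    rw [← exp_add, ← exp_add]
    congr 1
    push_cast
    ring
  have hL : ∫ s in (-1 : ℝ)..0, exp (-(I * Real.pi * k * s)) * exp (I * θ * (1 - 2 * |s| : ℝ)) =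
      exp (I * θ) * ((exp (-I * (2 * θ - Real.pi * k)) - 1) / (-I * (2 * θ - Real.pi * k))) := by
    rw [← hpart _ (mul_ne_zero (neg_ne_zero.2 I_ne_zero) hA2),
      ← intervalIntegral.integral_const_mul]
    have := intervalIntegral.integral_comp_neg (a := 0) (b := 1)
      (fun s : ℝ => exp (-(I * Real.pi * k * s)) * exp (I * θ * (1 - 2 * |s| : ℝ)))
    rw [neg_zero] at this
    rw [← this]
    refine intervalIntegral.integral_congr fun s hs => ?_
    rw [uIcc_of_le zero_le_one] at hs
    simp only [abs_neg, abs_of_nonneg hs.1]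
    rw [← exp_add, ← exp_add]
    congr 1
    push_cast
    ring
  have hcont : Continuous fun s : ℝ =>
      exp (-(I * Real.pi * k * s)) * exp (I * θ * (1 - 2 * |s| : ℝ)) := by
    fun_prop
  have hint : fourierCoeffOn h (fun s : ℝ => exp (I * θ * (1 - 2 * |s| : ℝ))) k =
      1 / 2 * ∫ s in (-1 : ℝ)..1,
        exp (-(I * Real.pi * k * s)) * exp (I * θ * (1 - 2 * |s| : ℝ)) := by
    rw [fourierCoeffOn_eq_integral, ← Complex.coe_smul, smul_eq_mul]
    congr 1
    · push_cast; norm_num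
    refine intervalIntegral.integral_congr fun s _ => ?_
    simp only [fourier_coe_apply, smul_eq_mul]
    congr 2
    push_cast
    field_simp
    ring
  rw [hint, ← intervalIntegral.integral_add_adjacent_intervals
    (hcont.intervalIntegrable _ 0) (hcont.intervalIntegrable 0 _), hL, hR]
  have e1 : exp (I * θ) * exp (-I * (2 * θ + Real.pi * k)) =
      exp (-(I * θ)) * exp (-(k * (Real.pi * I))) := by
    rw [← exp_add, ← exp_add]; congr 1; ring
  have e2 : exp (I * θ) * exp (-I * (2 * θ - Real.pi * k)) =
      exp (-(I * θ)) * exp (k * (Real.pi * I)) := by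
    rw [← exp_add, ← exp_add]; congr 1; ring
  have e3 : exp (k * (Real.pi * I)) = (-1) ^ k := by rw [exp_int_mul, exp_pi_mul_I]
  have e4 : exp (-(k * (Real.pi * I))) = (-1) ^ k := by
    rw [exp_neg, e3]
    rcases Int.even_or_odd k with hk | hk
    · simp [hk.neg_one_zpow]
    · rw [hk.neg_one_zpow]; norm_num
  have e5 : exp (I * θ) = Real.cos θ + Real.sin θ * I := by
    rw [mul_comm, exp_mul_I]; push_cast; rfl
  have e6 : exp (-(I * θ)) = Real.cos θ - Real.sin θ * I := by
    rw [show -(I * θ) = ((-θ : ℝ) : ℂ) * I by push_cast; ring, exp_mul_I]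
    rw [← ofReal_cos, ← ofReal_sin, Real.cos_neg, Real.sin_neg]; push_cast; ring
  have hA3 : (4 * θ ^ 2 - Real.pi ^ 2 * k ^ 2 : ℂ) ≠ 0 := by
    have := mul_ne_zero hA1 hA2
    ring_nf at this ⊢
    exact this
  have e7 : 1 / 2 * (exp (I * θ) *
        ((exp (-I * (2 * θ - Real.pi * k)) - 1) / (-I * (2 * θ - Real.pi * k))) + exp (I * θ) * ((exp (-I * (2 * θ + Real.pi * k)) - 1) / (-I * (2 * θ + Real.pi * k)))) =
      (exp (I * θ) - (-1) ^ k * exp (-(I * θ))) / (2 * I) *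
        (4 * θ / (4 * θ ^ 2 - Real.pi ^ 2 * k ^ 2)) := by
    rw [← mul_div_assoc, ← mul_div_assoc, mul_sub_one (exp (I * θ)), mul_sub_one (exp (I * θ)),
      e1, e2, e3, e4]
    rw [show (4 * θ ^ 2 - Real.pi ^ 2 * k ^ 2 : ℂ) =
      (2 * θ + Real.pi * k) * (2 * θ - Real.pi * k) by ring]
    field_simp
    ring
  rw [e7, e5, e6]
  unfold kadecCoeff
  have hI := I_ne_zero
  have h0' : (θ : ℂ) ≠ 0 := ofReal_ne_zero.2 h0
  by_cases hk0 : k = 0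
  · rw [if_pos hk0, hk0, Real.sinc_of_ne_zero h0]
    push_cast
    simp only [zpow_zero]
    field_simp
    ring_nf
  rw [if_neg hk0]
  rcases Int.even_or_odd k with hk | hk
  · rw [if_pos hk, hk.neg_one_zpow]
    push_cast
    field_simp
    ring
  · rw [if_neg (Int.not_even_iff_odd.2 hk), hk.neg_one_zpow]
    push_cast
    field_simp
    ring_nf
    rw [I_sq]
    ring

open Complex in
/-- The expansion of `exp (iθ(1 - 2s))`, `0 ≤ s ≤ 1`, into the cosines `cos (πks)`, written with
exponentials. -/
theorem hasSum_kadecCoeff {θ : ℝ} (hθ : |θ| < Real.pi / 4) {s : ℝ} (hs : s ∈ Icc (0 : ℝ) 1) :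
    HasSum (fun k : ℤ => kadecCoeff θ k * exp (I * Real.pi * k * s))
      (exp (I * θ * (1 - 2 * s : ℝ))) := by
  by_cases h0 : θ = 0
  · subst h0
    have : exp (I * (0 : ℝ) * (1 - 2 * s : ℝ)) =
        kadecCoeff 0 0 * exp (I * Real.pi * (0 : ℤ) * s) := by
      simp [kadecCoeff]
    rw [this]
    refine hasSum_single 0 fun k hk => ?_
    simp [kadecCoeff, hk]
  have : Fact (0 < (2 : ℝ)) := ⟨two_pos⟩
  let f : ℝ → ℂ := fun s : ℝ => exp (I * θ * (1 - 2 * |s| : ℝ))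
  have hf : Continuous f := by fun_prop
  have hF : Continuous (AddCircle.liftIco 2 (-1) f) := by
    refine AddCircle.liftIco_continuous ?_ hf.continuousOn
    simp only [f]
    norm_num
  have hco : fourierCoeff (⟨_, hF⟩ : C(AddCircle (2 : ℝ), ℂ)) = kadecCoeff θ := by
    ext k
    change fourierCoeff (AddCircle.liftIco 2 (-1) f) k = _
    rw [fourierCoeff_liftIco_eq]
    exact fourierCoeffOn_exp_abs hθ h0 (by norm_num) _ k
  have key := has_pointwise_sum_fourier_series_of_summable
    (f := (⟨_, hF⟩ : C(AddCircle (2 : ℝ), ℂ))) (by rw [hco]; exact summable_kadecCoeff hθ)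
    ((-s : ℝ) : AddCircle (2 : ℝ))
  -- evaluation at `-s` avoids the right endpoint of `[-1, 1)`
  have hv : (⟨_, hF⟩ : C(AddCircle (2 : ℝ), ℂ)) ((-s : ℝ) : AddCircle (2 : ℝ)) =
      exp (I * θ * (1 - 2 * s : ℝ)) := by
    change AddCircle.liftIco 2 (-1) f ((-s : ℝ) : AddCircle (2 : ℝ)) = _
    rw [AddCircle.liftIco_coe_apply ⟨by linarith [hs.2], by linarith [hs.1]⟩]
    simp only [f, abs_neg, abs_of_nonneg hs.1]
  rw [hv, hco, ← (Equiv.neg ℤ).hasSum_iff] at key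
  convert key using 2 with k
  simp only [Function.comp, Equiv.neg_apply, fourier_coe_apply, smul_eq_mul]
  congr 1
  · simp [kadecCoeff]
  · congr 1
    push_cast
    field_simp

/-- The supremum over `|θ| ≤ Θ` of the absolute value of the `k`-th coefficient of
`exp (iθ(1 - 2|s|)) - 1`. It is attained at `θ = Θ`, where the signs and phases of the coefficients
give the closed form below, so that the sum over `k` can be read off from the series at `s = 0`. -/
noncomputable def kadecBound (Θ : ℝ) (k : ℤ) : ℝ :=
  (if k = 0 then 1 else 0) - (kadecCoeff Θ k).re + (kadecCoeff Θ k).im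

theorem hasSum_kadecBound {Θ : ℝ} (hΘ : |Θ| < Real.pi / 4) :
    HasSum (kadecBound Θ) (1 - Real.cos Θ + Real.sin Θ) := by
  have h := hasSum_kadecCoeff hΘ (s := 0) ⟨le_rfl, zero_le_one⟩
  simp only [Complex.ofReal_zero, mul_zero, Complex.exp_zero, mul_one, sub_zero,
    Complex.ofReal_one] at h
  rw [mul_comm, Complex.exp_mul_I] at h
  have hre := Complex.hasSum_re h
  have him := Complex.hasSum_im h
  simp only [Complex.add_re, Complex.mul_re, Complex.I_re, Complex.I_im, mul_zero, mul_one,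
    Complex.cos_ofReal_re, Complex.sin_ofReal_im, Complex.add_im, Complex.mul_im,
    Complex.cos_ofReal_im, Complex.sin_ofReal_re, add_zero, zero_add, sub_self] at hre him
  exact ((hasSum_ite_eq (0 : ℤ) (1 : ℝ)).sub hre).add him

theorem sinc_le_sinc_of_abs_le {θ Θ : ℝ} (h : |θ| ≤ Θ) (hΘ : Θ ≤ Real.pi) :
    Real.sinc Θ ≤ Real.sinc θ := by
  have habs : Real.sinc |θ| = Real.sinc θ := by
    rcases abs_choice θ with h | h <;> rw [h]
    exact Real.sinc_neg θ
  rw [← habs]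
  rcases (abs_nonneg θ).eq_or_lt with h0 | h0
  · rw [← h0, Real.sinc_zero]; exact Real.sinc_le_one _
  have hΘ0 : 0 < Θ := h0.trans_le h
  rw [Real.sinc_of_ne_zero h0.ne', Real.sinc_of_ne_zero hΘ0.ne', div_le_div_iff₀ hΘ0 h0]
  have h1 : |θ| / Θ ≤ 1 := by rw [div_le_one hΘ0]; exact h
  have := strictConcaveOn_sin_Icc.concaveOn.2 (⟨hΘ0.le, hΘ⟩ : Θ ∈ Icc 0 Real.pi)
    (⟨le_rfl, Real.pi_pos.le⟩ : (0 : ℝ) ∈ Icc 0 Real.pi) (div_nonneg h0.le hΘ0.le)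
    (sub_nonneg.2 h1) (by ring)
  simp only [smul_eq_mul, mul_zero, add_zero, Real.sin_zero] at this
  rw [div_mul_cancel₀ _ hΘ0.ne'] at this
  have h2 := mul_le_mul_of_nonneg_right this hΘ0.le
  rw [div_mul_eq_mul_div, div_mul_cancel₀ _ hΘ0.ne'] at h2
  linarith

theorem mul_cos_le_mul_cos {x y : ℝ} (hx : 0 ≤ x) (hxy : x ≤ y) (hy : y ≤ Real.pi / 4) :
    x * Real.cos x ≤ y * Real.cos y := by
  have hm : MonotoneOn (fun x : ℝ => x * Real.cos x) (Icc 0 (Real.pi / 4)) := by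
    refine monotoneOn_of_deriv_nonneg (convex_Icc _ _) (by fun_prop) (by fun_prop) fun z hz => ?_
    rw [interior_Icc] at hz
    have hd : HasDerivAt (fun x : ℝ => x * Real.cos x) (1 * Real.cos z + z * -Real.sin z) z :=
      (hasDerivAt_id z).mul (Real.hasDerivAt_cos z)
    rw [hd.deriv]
    have hs : Real.sin z ≤ Real.cos z := by
      rw [← Real.cos_pi_div_two_sub]
      exact Real.cos_le_cos_of_nonneg_of_le_pi hz.1.le (by linarith [Real.pi_pos, hz.1])
        (by linarith [hz.2])
    have h0 : 0 ≤ Real.sin z := Real.sin_nonneg_of_nonneg_of_le_pi hz.1.le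
      (by linarith [Real.pi_pos, hz.2])
    have := Real.pi_lt_four
    nlinarith [hz.1, hz.2]
  exact hm ⟨hx, hxy.trans hy⟩ ⟨hx.trans hxy, hy⟩ hxy

theorem norm_kadecCoeff_sub_le {θ Θ : ℝ} (h : |θ| ≤ Θ) (hΘ : Θ < Real.pi / 4) (k : ℤ) :
    ‖kadecCoeff θ k - (if k = 0 then 1 else 0 : ℝ)‖ ≤ kadecBound Θ k := by
  have hθ0 := abs_nonneg θ
  have hpi := Real.pi_pos
  by_cases hk : k = 0
  · subst hk
    simp only [kadecCoeff, kadecBound, if_true]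
    rw [← Complex.ofReal_sub, Complex.norm_real, Real.norm_eq_abs, abs_sub_comm,
      abs_of_nonneg (by linarith [Real.sinc_le_one θ]), Complex.ofReal_re, Complex.ofReal_im]
    linarith [sinc_le_sinc_of_abs_le h (by linarith)]
  have hΘ' : |Θ| < Real.pi / 4 := by rwa [abs_of_nonneg (hθ0.trans h)]
  have hd := kadec_denom_bound hΘ' hk
  have hD : 0 < Real.pi ^ 2 * (k : ℝ) ^ 2 - 4 * Θ ^ 2 := by
    have : 0 < 3 * Real.pi ^ 2 / 4 * (k : ℝ) ^ 2 := by positivity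
    linarith
  have hsq : θ ^ 2 ≤ Θ ^ 2 := sq_le_sq' (by linarith [neg_abs_le θ]) (by linarith [le_abs_self θ])
  -- each coefficient is an increasing numerator over a decreasing positive denominator
  have key : ∀ a A : ℝ, |θ| * |a| ≤ Θ * A →
      |a * (4 * θ / (4 * θ ^ 2 - Real.pi ^ 2 * k ^ 2))| ≤
        -(A * (4 * Θ / (4 * Θ ^ 2 - Real.pi ^ 2 * k ^ 2))) := by
    intro a A haA
    have h1 : -(A * (4 * Θ / (4 * Θ ^ 2 - Real.pi ^ 2 * k ^ 2))) =
        4 * (Θ * A) / (Real.pi ^ 2 * k ^ 2 - 4 * Θ ^ 2) := by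
      rw [← neg_sub (Real.pi ^ 2 * (k : ℝ) ^ 2), div_neg]
      ring
    rw [h1, ← mul_div_assoc, abs_div,
      abs_of_neg (by linarith : 4 * θ ^ 2 - Real.pi ^ 2 * (k : ℝ) ^ 2 < 0),
      neg_sub, abs_mul, abs_mul, abs_of_pos (four_pos : (0 : ℝ) < 4)]
    have h2 : |a| * (4 * |θ|) ≤ 4 * (Θ * A) := by linarith
    have h3 : 0 ≤ |a| * (4 * |θ|) := by positivity
    gcongr
    exact h3.trans h2
  rw [if_neg hk, Complex.ofReal_zero, sub_zero]
  unfold kadecBound kadecCoeff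
  simp only [if_neg hk]
  split_ifs with he
  · rw [Complex.norm_real, Real.norm_eq_abs, Complex.ofReal_re, Complex.ofReal_im, zero_sub,
      add_zero]
    refine key _ _ ?_
    rw [Real.abs_sin_eq_sin_abs_of_abs_le_pi (by linarith)]
    have h4 : Real.sin |θ| ≤ Real.sin Θ :=
      Real.sin_le_sin_of_le_of_le_pi_div_two (by linarith) (by linarith) h
    have h5 : 0 ≤ Real.sin |θ| := Real.sin_nonneg_of_nonneg_of_le_pi hθ0 (by linarith)
    exact mul_le_mul h h4 h5 (hθ0.trans h)
  · rw [norm_mul, norm_neg, Complex.norm_I, one_mul, Complex.norm_real, Real.norm_eq_abs]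
    simp only [neg_mul, Complex.neg_re, Complex.neg_im, Complex.I_mul_re, Complex.I_mul_im,
      Complex.ofReal_re, Complex.ofReal_im, neg_zero, sub_zero, zero_add]
    refine key _ _ ?_
    rw [← Real.cos_abs θ, abs_of_nonneg (Real.cos_nonneg_of_neg_pi_div_two_le_of_le
      (by linarith) (by linarith))]
    exact mul_cos_le_mul_cos hθ0 h hΘ.le

open scoped BoundedContinuousFunction in
/-- A pointwise expansion in exponentials with summable coefficients converges in `L²`. -/
theorem hasSum_expL2_of_pointwise {κ : Type*} {T : ℝ} {c : κ → ℂ} (hc : Summable c) {v : κ → ℝ}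
    {w : ℝ} {a : ℂ}
    (h : ∀ t ∈ Ioo (0 : ℝ) T, HasSum (fun k => c k * Complex.exp (Complex.I * v k * t))
      (a * Complex.exp (Complex.I * w * t))) :
    HasSum (fun k => c k • expL2 T (v k)) (a • expL2 T w) := by
  let E : ℝ → ℝ →ᵇ ℂ := fun w => BoundedContinuousFunction.ofNormedAddCommGroup
    (fun t : ℝ => Complex.exp (Complex.I * w * t)) (by fun_prop) 1
    (fun t => (norm_exp_I_mul_mul w t).le)
  have hE : ∀ w, BoundedContinuousFunction.toLp 2 (vol 0 T) ℂ (E w) = expL2 T w := fun w => by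
    refine Lp.ext ?_
    filter_upwards [BoundedContinuousFunction.coeFn_toLp 2 (vol 0 T) ℂ (E w), coeFn_expL2 T w]
      with t h1 h2
    rw [h1, h2]
    rfl
  have hs : Summable fun k => c k • E (v k) := by
    refine Summable.of_norm_bounded hc.norm fun k => ?_
    rw [norm_smul]
    exact mul_le_of_le_one_right (norm_nonneg _)
      (BoundedContinuousFunction.norm_ofNormedAddCommGroup_le _ zero_le_one _)
  have hsum := hs.hasSum.mapL (BoundedContinuousFunction.toLp (E := ℂ) 2 (vol 0 T) ℂ)
  simp only [map_smul, hE] at hsum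
  convert hsum using 1
  refine Lp.ext ?_
  filter_upwards [BoundedContinuousFunction.coeFn_toLp 2 (vol 0 T) ℂ (∑' k, c k • E (v k)),
    coeFn_expL2 T w, Lp.coeFn_smul a (expL2 T w), ae_restrict_mem measurableSet_Ioo]
    with t h1 h2 h3 ht
  rw [h1, h3, Pi.smul_apply, h2, smul_eq_mul]
  exact (h t ht).unique (hs.hasSum.mapL (BoundedContinuousFunction.evalCLM ℂ t))

/-- **Kadec's 1/4 theorem**: real frequencies whose deviation from `2πn/T` is at most a quarter of
the spacing `2π/T`, uniformly strictly, give a Riesz basis of exponentials in `L²(0, T)`. -/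
theorem isRieszBasis_expL2 {T Θ : ℝ} (hT : 0 < T) (hΘ : Θ < Real.pi / 4) (w : ℤ → ℝ)
    (hw : ∀ n : ℤ, |w n - 2 * Real.pi * n / T| * T ≤ 2 * Θ) :
    IsRieszBasis (fun n : ℤ => expL2 T (w n)) := by
  -- `e^(i w_n t) = e^(2πint/T) e^(-iθ_n) e^(iθ_n(1 - 2t/T))`; the phase goes into the basis
  let θ : ℤ → ℝ := fun n => -((w n - 2 * Real.pi * n / T) * T / 2)
  have hθ : ∀ n, |θ n| ≤ Θ := fun n => by
    simp only [θ, abs_neg, abs_div, abs_mul, abs_of_pos hT, abs_of_pos (two_pos : (0 : ℝ) < 2)]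
    linarith [hw n]
  have hΘ0 : 0 ≤ Θ := (abs_nonneg _).trans (hθ 0)
  have hΘ' : |Θ| < Real.pi / 4 := by rwa [abs_of_nonneg hΘ0]
  let u : ℤ → ℂ := fun n => Complex.exp (Complex.I * (-θ n : ℝ) * (1 : ℝ))
  have hu : ∀ n, ‖u n‖ = 1 := fun n => norm_exp_I_mul_mul _ _
  obtain ⟨b, hb⟩ := exists_hilbertBasis_expL2 hT u hu
  have hsT : ((√T : ℝ) : ℂ) ≠ 0 := by
    rw [Complex.ofReal_ne_zero]; positivity
  -- multiplying by a character `e^(iπkt/T)` keeps the family orthonormal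
  let P : ℤ → ℤ → Lp ℂ 2 (vol 0 T) := fun k n =>
    (u n / (√T : ℝ)) • expL2 T (2 * Real.pi * n / T + Real.pi * k / T)
  have hP : ∀ k, Orthonormal ℂ (P k) := fun k => by
    refine orthonormal_expL2 hT u hu _ fun n m hnm => ⟨m - n, sub_ne_zero.2 hnm.symm, ?_⟩
    push_cast
    field_simp
    ring
  let C : ℤ → ℤ → ℂ := fun k n => -(kadecCoeff (θ n) k - (if k = 0 then 1 else 0 : ℝ))
  have hC : ∀ k n, ‖C k n‖ ≤ kadecBound Θ k := fun k n => by
    rw [norm_neg]; exact norm_kadecCoeff_sub_le (hθ n) hΘ k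
  let g : ℤ → Lp ℂ 2 (vol 0 T) := fun n => b n - (1 / (√T : ℝ) : ℂ) • expL2 T (w n)
  have hexp : ∀ n, HasSum (fun k => kadecCoeff (θ n) k • P k n)
      ((1 / (√T : ℝ) : ℂ) • expL2 T (w n)) := by
    intro n
    have h := (hasSum_expL2_of_pointwise (T := T)
      (summable_kadecCoeff ((hθ n).trans_lt hΘ))
      (v := fun k : ℤ => 2 * Real.pi * n / T + Real.pi * k / T) (w := w n)
      (a := Complex.exp (Complex.I * θ n)) fun t ht => ?_).const_smul (u n / (√T : ℝ))
    · convert h using 1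
      · ext1 k
        simp only [P, smul_smul, mul_comm]
      · rw [smul_smul]
        congr 1
        rw [div_mul_eq_mul_div, ← Complex.exp_add]
        congr 1
        simp
    · have hs : t / T ∈ Icc (0 : ℝ) 1 :=
        ⟨div_nonneg ht.1.le hT.le, (div_le_one hT).2 ht.2.le⟩
      have h := (hasSum_kadecCoeff ((hθ n).trans_lt hΘ) hs).mul_right
        (Complex.exp (Complex.I * (2 * Real.pi * n / T * t)))
      have hT' : (T : ℂ) ≠ 0 := Complex.ofReal_ne_zero.2 hT.ne'
      rw [← Complex.exp_add] at h
      refine (congrArg₂ (fun F A => HasSum F A) (funext fun k => ?_) ?_).mp h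
      · rw [mul_assoc, ← Complex.exp_add]
        congr 2
        push_cast
        field_simp
        ring
      · rw [← Complex.exp_add]
        congr 1
        simp only [θ]
        push_cast
        field_simp
        ring
  have hg : ∀ n, HasSum (fun k => C k n • P k n) (g n) := by
    intro n
    have h1 : HasSum (fun k : ℤ => (if k = 0 then 1 else 0 : ℂ) • P k n) (b n) := by
      have : b n = (if (0 : ℤ) = 0 then 1 else 0 : ℂ) • P 0 n := by simp [hb, P]
      rw [this]
      exact hasSum_single 0 fun k hk => by simp [hk]
    convert h1.sub (hexp n) using 2 with k
    rw [← sub_smul]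
    congr 1
    simp only [C]
    split_ifs <;> push_cast <;> ring
  refine isRieszBasis_of_bound b _ g hsT (fun n => ?_) ?_ ?_
    (norm_sum_smul_le_of_hasSum_orthonormal hP hC (hasSum_kadecBound hΘ') hg)
  · simp only [g, sub_sub_cancel, smul_smul]
    rw [mul_one_div_cancel hsT, one_smul]
  · have := Real.cos_le_one Θ
    have := Real.sin_nonneg_of_nonneg_of_le_pi hΘ0 (by linarith [Real.pi_pos])
    linarith
  · have : Real.sin Θ < Real.cos Θ := by
      rw [← Real.cos_pi_div_two_sub]
      exact Real.cos_lt_cos_of_nonneg_of_le_pi hΘ0 (by linarith [Real.pi_pos]) (by linarith)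
    linarith

end DegWave

/-! ### The Poisson integral for Bessel functions -/

namespace DegWave

/-- The Poisson integral `∫₀¹ cos (zt) (1 - t²)^p dt`; up to a constant it is
`z^(-μ) J_μ(z)` for the Bessel function of order `μ = p + 1/2`. -/
noncomputable def poissonBessel (p z : ℝ) : ℝ :=
  ∫ t in (0 : ℝ)..1, Real.cos (z * t) * (1 - t ^ 2) ^ p

/-- The derivative of `poissonBessel p`. -/
noncomputable def poissonBesselDeriv (p z : ℝ) : ℝ :=
  ∫ t in (0 : ℝ)..1, -(t * Real.sin (z * t)) * (1 - t ^ 2) ^ p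

theorem continuous_one_sub_sq_rpow {p : ℝ} (hp : 0 ≤ p) :
    Continuous fun t : ℝ => (1 - t ^ 2) ^ p :=
  (by fun_prop : Continuous fun t : ℝ => 1 - t ^ 2).rpow_const fun _ => Or.inr hp

theorem one_sub_sq_rpow_mem {p t : ℝ} (hp : 0 ≤ p) (ht : t ∈ Icc (0 : ℝ) 1) :
    (1 - t ^ 2) ^ p ∈ Icc (0 : ℝ) 1 := by
  have h0 : 0 ≤ 1 - t ^ 2 := by nlinarith [ht.1, ht.2]
  exact ⟨Real.rpow_nonneg h0 p, Real.rpow_le_one h0 (by nlinarith [sq_nonneg t]) hp⟩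

theorem hasDerivAt_weighted_integral {p : ℝ} (hp : 0 ≤ p) {F F' : ℝ → ℝ → ℝ}
    (hF : ∀ z, Continuous (F z)) (hF' : ∀ z, Continuous (F' z))
    (hd : ∀ z t, HasDerivAt (fun z => F z t) (F' z t) z)
    (hb : ∀ z, ∀ t ∈ Icc (0 : ℝ) 1, |F' z t| ≤ 1) (z : ℝ) :
    HasDerivAt (fun z => ∫ t in (0 : ℝ)..1, F z t * (1 - t ^ 2) ^ p)
      (∫ t in (0 : ℝ)..1, F' z t * (1 - t ^ 2) ^ p) z := by
  have hw := continuous_one_sub_sq_rpow hp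
  refine (intervalIntegral.hasDerivAt_integral_of_dominated_loc_of_deriv_le (𝕜 := ℝ) (E := ℝ)
    (F := fun z t => F z t * (1 - t ^ 2) ^ p) (F' := fun z t => F' z t * (1 - t ^ 2) ^ p)
    (bound := fun _ => 1) Filter.univ_mem ?_ ?_ ?_ ?_ ?_ ?_).2
  · exact Filter.Eventually.of_forall fun z => ((hF z).mul hw).aestronglyMeasurable
  · exact ((hF z).mul hw).intervalIntegrable _ _
  · exact ((hF' z).mul hw).aestronglyMeasurable
  · refine ae_of_all _ fun t ht x _ => ?_
    rw [uIoc_of_le zero_le_one] at ht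
    have ht' := Ioc_subset_Icc_self ht
    have h1 := one_sub_sq_rpow_mem hp ht'
    rw [Real.norm_eq_abs, abs_mul, abs_of_nonneg h1.1]
    exact mul_le_one₀ (hb x t ht') h1.1 h1.2
  · exact intervalIntegrable_const
  · exact ae_of_all _ fun t _ x _ => (hd x t).mul_const _

theorem hasDerivAt_poissonBessel {p : ℝ} (hp : 0 ≤ p) (z : ℝ) :
    HasDerivAt (poissonBessel p) (poissonBesselDeriv p z) z := by
  refine hasDerivAt_weighted_integral hp (F := fun z t => Real.cos (z * t))
    (F' := fun z t => -(t * Real.sin (z * t))) (fun z => by fun_prop) (fun z => by fun_prop)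
    (fun z t => ?_) (fun z t ht => ?_) z
  · exact (hasDerivAt_mul_const t).cos.congr_deriv (by ring)
  · rw [abs_neg, abs_mul, abs_of_nonneg ht.1]
    exact mul_le_one₀ ht.2 (abs_nonneg _) (Real.abs_sin_le_one _)

/-- The second derivative of the Poisson integral, times `z`, expressed by the integral and its
first derivative. -/
theorem integral_sq_mul_cos_eq {p : ℝ} (hp : 0 ≤ p) (z : ℝ) :
    z * (∫ t in (0 : ℝ)..1, -(t ^ 2 * Real.cos (z * t)) * (1 - t ^ 2) ^ p) =
      -((2 * p + 2) * poissonBesselDeriv p z) - z * poissonBessel p z := by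
  have hw := continuous_one_sub_sq_rpow hp
  have hw1 := continuous_one_sub_sq_rpow (p := p + 1) (by linarith)
  -- integrate the derivative of `sin (zt) (1 - t²)^(p+1)`, which vanishes at both ends
  have hd : ∀ t : ℝ, HasDerivAt (fun t : ℝ => Real.sin (z * t) * (1 - t ^ 2) ^ (p + 1))
      (z * Real.cos (z * t) * (1 - t ^ 2) ^ (p + 1) +
        Real.sin (z * t) * (-(2 * t) * (p + 1) * (1 - t ^ 2) ^ p)) t := fun t => by
    have h1 : HasDerivAt (fun t : ℝ => Real.sin (z * t)) (z * Real.cos (z * t)) t := by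
      exact (hasDerivAt_const_mul z).sin.congr_deriv (by ring)
    have h2 : HasDerivAt (fun t : ℝ => 1 - t ^ 2) (-(2 * t)) t := by
      simpa using (hasDerivAt_pow 2 t).const_sub 1
    have h3 := h2.rpow_const (p := p + 1) (Or.inr (by linarith))
    rw [add_sub_cancel_right] at h3
    exact h1.mul h3
  have hftc := intervalIntegral.integral_eq_sub_of_hasDerivAt (a := 0) (b := 1)
    (fun t _ => hd t) (Continuous.intervalIntegrable (by fun_prop) _ _)
  have h0 : (0 : ℝ) ^ (p + 1) = 0 := Real.zero_rpow (by linarith)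
  simp only [one_pow, sub_self, h0, mul_zero, Real.sin_zero, zero_mul] at hftc
  unfold poissonBesselDeriv poissonBessel
  rw [← intervalIntegral.integral_const_mul, ← intervalIntegral.integral_const_mul,
    ← intervalIntegral.integral_const_mul, eq_sub_iff_add_eq, ← sub_eq_zero, sub_neg_eq_add,
    ← intervalIntegral.integral_add (Continuous.intervalIntegrable (by fun_prop) _ _)
      (Continuous.intervalIntegrable (by fun_prop) _ _),
    ← intervalIntegral.integral_add (Continuous.intervalIntegrable (by fun_prop) _ _)
      (Continuous.intervalIntegrable (by fun_prop) _ _)]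
  refine Eq.trans ?_ hftc
  refine intervalIntegral.integral_congr fun t ht => ?_
  rw [uIcc_of_le zero_le_one] at ht
  have h1 : (1 - t ^ 2) ^ (p + 1) = (1 - t ^ 2) ^ p * (1 - t ^ 2) :=
    Real.rpow_add_one' (by nlinarith [ht.1, ht.2]) (by linarith)
  simp only [h1]
  ring

theorem hasDerivAt_poissonBesselDeriv_integral {p : ℝ} (hp : 0 ≤ p) (z : ℝ) :
    HasDerivAt (poissonBesselDeriv p)
      (∫ t in (0 : ℝ)..1, -(t ^ 2 * Real.cos (z * t)) * (1 - t ^ 2) ^ p) z := by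
  refine hasDerivAt_weighted_integral hp (F := fun z t => -(t * Real.sin (z * t)))
    (F' := fun z t => -(t ^ 2 * Real.cos (z * t))) (fun z => by fun_prop) (fun z => by fun_prop)
    (fun z t => ?_) (fun z t ht => ?_) z
  · exact ((hasDerivAt_mul_const t).sin.const_mul t).neg.congr_deriv (by ring)
  · rw [abs_neg, abs_mul, abs_of_nonneg (sq_nonneg t)]
    exact mul_le_one₀ (pow_le_one₀ ht.1 ht.2) (abs_nonneg _) (Real.abs_cos_le_one _)

/-- The Bessel equation `z I'' + (2p + 2) I' + z I = 0` for the Poisson integral. -/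
theorem hasDerivAt_poissonBesselDeriv {p : ℝ} (hp : 0 ≤ p) {z : ℝ} (hz : z ≠ 0) :
    HasDerivAt (poissonBesselDeriv p)
      (-((2 * p + 2) / z * poissonBesselDeriv p z) - poissonBessel p z) z := by
  refine (hasDerivAt_poissonBesselDeriv_integral hp z).congr_deriv (mul_left_cancel₀ hz ?_)
  rw [integral_sq_mul_cos_eq hp z]
  field_simp

theorem continuous_poissonBesselDeriv {p : ℝ} (hp : 0 ≤ p) : Continuous (poissonBesselDeriv p) :=
  continuous_iff_continuousAt.2 fun z =>
    (hasDerivAt_poissonBesselDeriv_integral hp z).continuousAt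

theorem continuous_poissonBessel {p : ℝ} (hp : 0 ≤ p) : Continuous (poissonBessel p) :=
  continuous_iff_continuousAt.2 fun z => (hasDerivAt_poissonBessel hp z).continuousAt

theorem poissonBessel_pos {p z : ℝ} (hp : 0 ≤ p) (hz : 0 ≤ z) (hz' : z ≤ Real.pi / 2) :
    0 < poissonBessel p z := by
  have hw := continuous_one_sub_sq_rpow hp
  refine intervalIntegral.intervalIntegral_pos_of_pos_on
    (Continuous.intervalIntegrable (by fun_prop) _ _) (fun t ht => ?_) one_pos
  have h1 : 0 < 1 - t ^ 2 := by nlinarith [ht.1, ht.2]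
  have h2 : z * t < Real.pi / 2 := by
    rcases hz.eq_or_lt with rfl | h
    · rw [zero_mul]; exact Real.pi_div_two_pos
    · nlinarith [ht.1, ht.2]
  have h3 : 0 ≤ z * t := mul_nonneg hz ht.1.le
  exact mul_pos (Real.cos_pos_of_mem_Ioo ⟨by linarith [Real.pi_pos], h2⟩)
    (Real.rpow_pos_of_pos h1 p)

open Complex in
/-- The integrand of the Poisson integral on the complex plane. -/
noncomputable def poissonKernel (p z : ℝ) (ζ : ℂ) : ℂ := exp (I * z * ζ) * (1 - ζ ^ 2) ^ (p : ℂ)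

open Complex in
/-- Cauchy's theorem on the rectangle `[0, 1] × [0, R]`: the left side contributes only to the
imaginary part. -/
theorem poissonBessel_eq_contour {p : ℝ} (hp : 0 ≤ p) (z R : ℝ) :
    poissonBessel p z = (∫ x in (0 : ℝ)..1, poissonKernel p z (x + R * I)).re +
      (∫ y in (0 : ℝ)..R, poissonKernel p z (1 + y * I)).im := by
  have hre : ∀ ζ : ℂ, (1 - ζ ^ 2).re = 1 - ζ.re ^ 2 + ζ.im ^ 2 := fun ζ => by
    simp [sq]; ring
  have hc : ContinuousOn (poissonKernel p z) (uIcc (0 : ℂ).re (1 + R * I : ℂ).re ×ℂ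
      uIcc (0 : ℂ).im (1 + R * I : ℂ).im) := by
    intro ζ hζ
    refine ContinuousAt.continuousWithinAt ?_
    have h1 : ContinuousAt (fun ζ : ℂ => exp (I * z * ζ)) ζ := by fun_prop
    refine h1.mul ?_
    rcases hp.eq_or_lt with rfl | hp
    · simpa using continuousAt_const
    · refine ContinuousAt.comp (f := fun ζ : ℂ => 1 - ζ ^ 2) (g := fun w : ℂ => w ^ (p : ℂ)) ?_
        (by fun_prop)
      refine continuousAt_cpow_const_of_re_pos (Or.inl ?_) (by simpa using hp)
      rw [hre]
      have h2 := hζ.1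
      simp at h2
      have : ζ.re ^ 2 ≤ 1 := by nlinarith [h2.1, h2.2]
      nlinarith [sq_nonneg ζ.im]
  have hd : DifferentiableOn ℂ (poissonKernel p z)
      (Ioo (min (0 : ℂ).re (1 + R * I : ℂ).re) (max (0 : ℂ).re (1 + R * I : ℂ).re) ×ℂ
        Ioo (min (0 : ℂ).im (1 + R * I : ℂ).im) (max (0 : ℂ).im (1 + R * I : ℂ).im)) := by
    intro ζ hζ
    have h2 := hζ.1
    simp at h2
    refine DifferentiableAt.differentiableWithinAt ?_
    refine DifferentiableAt.mul (by fun_prop) (DifferentiableAt.cpow (by fun_prop) (by fun_prop) ?_)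
    refine Or.inl ?_
    rw [hre]
    have : ζ.re ^ 2 < 1 := by nlinarith [h2.1, h2.2]
    nlinarith [sq_nonneg ζ.im]
  have h := integral_boundary_rect_eq_zero_of_continuousOn_of_differentiableOn
    (poissonKernel p z) 0 (1 + R * I) hc hd
  simp only [zero_re, zero_im, add_re, one_re, mul_re, ofReal_re, I_re, mul_zero, ofReal_im, I_im,
    mul_one, sub_self, add_zero, add_im, one_im, mul_im, zero_add, ofReal_zero, zero_mul,
    ofReal_one, smul_eq_mul] at h
  have hleft : ∫ y in (0 : ℝ)..R, poissonKernel p z (y * I) =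
      ((∫ y in (0 : ℝ)..R, Real.exp (-(z * y)) * (1 + y ^ 2) ^ p : ℝ) : ℂ) := by
    rw [← intervalIntegral.integral_ofReal]
    refine intervalIntegral.integral_congr fun y _ => ?_
    simp only [poissonKernel]
    rw [mul_pow, I_sq, ofReal_mul, ofReal_cpow (by positivity), ofReal_exp]
    congr 1
    · congr 1
      push_cast
      linear_combination (z * y : ℂ) * I_mul_I
    · push_cast; ring_nf
  have hbot_re : (∫ x in (0 : ℝ)..1, poissonKernel p z x).re = poissonBessel p z := by
    have hcont : Continuous fun x : ℝ => exp (I * z * x) * (((1 - x ^ 2) ^ p : ℝ) : ℂ) := by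
      have := continuous_one_sub_sq_rpow hp
      fun_prop
    have h1 : ∫ x in (0 : ℝ)..1, poissonKernel p z x =
        ∫ x in (0 : ℝ)..1, exp (I * z * x) * (((1 - x ^ 2) ^ p : ℝ) : ℂ) := by
      refine intervalIntegral.integral_congr fun x hx => ?_
      rw [uIcc_of_le zero_le_one] at hx
      simp only [poissonKernel]
      rw [ofReal_cpow (by nlinarith [hx.1, hx.2])]
      push_cast
      rfl
    rw [h1]
    rw [← reCLM_apply, ← ContinuousLinearMap.intervalIntegral_comp_comm _
      (hcont.intervalIntegrable _ _)]
    refine intervalIntegral.integral_congr fun x _ => ?_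
    simp only [reCLM_apply, re_mul_ofReal]
    congr 1
    rw [show I * z * x = ((z * x : ℝ) : ℂ) * I by push_cast; ring, exp_ofReal_mul_I_re]
  rw [hleft] at h
  have h2 := congrArg Complex.re h
  simp only [sub_re, add_re, I_mul_re, ofReal_im, neg_zero, sub_zero, zero_re, hbot_re] at h2
  linarith

end DegWave

/-! ### Location of the zeros -/

namespace DegWave

open Complex in
theorem tendsto_contour_top {p z : ℝ} (hp : 0 ≤ p) (hp1 : p ≤ 1) (hz : 0 < z) :
    Filter.Tendsto (fun R : ℝ => (∫ x in (0 : ℝ)..1, poissonKernel p z (x + R * I)).re)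
      Filter.atTop (nhds 0) := by
  have hb : ∀ R : ℝ, 0 ≤ R → |(∫ x in (0 : ℝ)..1, poissonKernel p z (x + R * I)).re| ≤
      (R ^ 2 + 2 * R + 2) * Real.exp (-z * R) := by
    intro R hR
    refine (abs_re_le_norm _).trans ?_
    have := intervalIntegral.norm_integral_le_of_norm_le_const (a := 0) (b := 1)
      (f := fun x : ℝ => poissonKernel p z (x + R * I))
      (C := (R ^ 2 + 2 * R + 2) * Real.exp (-z * R)) fun x hx => ?_
    · simpa using this
    rw [uIoc_of_le zero_le_one] at hx
    unfold poissonKernel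
    have h1 : ‖exp (I * z * (x + R * I))‖ = Real.exp (-z * R) := by
      rw [norm_exp]
      congr 1
      simp
    have h2 : ‖(1 - (x + R * I : ℂ) ^ 2)‖ ≤ R ^ 2 + 2 * R + 2 := by
      refine (norm_sub_le _ _).trans ?_
      have h3 : ‖(x + R * I : ℂ)‖ ≤ 1 + R := by
        refine (norm_add_le _ _).trans ?_
        rw [norm_mul, norm_I, mul_one, norm_real, norm_real, Real.norm_of_nonneg hx.1.le,
          Real.norm_of_nonneg hR]
        linarith [hx.2]
      rw [norm_pow, norm_one]
      nlinarith [norm_nonneg (x + R * I : ℂ)]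
    have h4 : ‖(1 - (x + R * I : ℂ) ^ 2) ^ (p : ℂ)‖ ≤ R ^ 2 + 2 * R + 2 := by
      rw [norm_cpow_real]
      refine (Real.rpow_le_rpow (norm_nonneg _) h2 hp).trans ?_
      refine (Real.rpow_le_rpow_of_exponent_le (by nlinarith) hp1).trans ?_
      rw [Real.rpow_one]
    rw [norm_mul, h1, mul_comm]
    gcongr
  have hlim : Filter.Tendsto (fun R : ℝ => (R ^ 2 + 2 * R + 2) * Real.exp (-z * R))
      Filter.atTop (nhds 0) := by
    have h : ∀ k : ℕ, Filter.Tendsto (fun R : ℝ => R ^ k * Real.exp (-z * R))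
        Filter.atTop (nhds 0) := fun k => by
      simpa using tendsto_rpow_mul_exp_neg_mul_atTop_nhds_zero k z hz
    have := ((h 2).add ((h 1).const_mul 2)).add ((h 0).const_mul 2)
    simp only [mul_zero, add_zero] at this
    refine this.congr fun R => ?_
    ring
  refine squeeze_zero_norm' ?_ hlim
  filter_upwards [Filter.eventually_ge_atTop 0] with R hR
  exact hb R hR

theorem neg_one_pow_mul_sin_pos {x : ℝ} {n : ℕ} (h1 : Real.pi * n < x)
    (h2 : x < Real.pi * (n + 1)) : 0 < (-1) ^ n * Real.sin x := by
  rw [← Real.sin_sub_nat_mul_pi]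
  exact Real.sin_pos_of_pos_of_lt_pi (by linarith) (by linarith)

open Complex in
/-- On the half-line above `1` the argument of `(1 - ζ²)^p` is between `-πp/2` and `0`, which fixes
the sign of the imaginary part of the kernel. -/
theorem poissonKernel_right_sign {p z : ℝ} (hp : 0 ≤ p) {n : ℕ}
    (h1 : Real.pi * n + Real.pi * p / 2 < z) (h2 : z < Real.pi * (n + 1)) {y : ℝ} (hy : 0 < y) :
    0 < (-1) ^ n * (poissonKernel p z (1 + y * I)).im := by
  have hsq : (1 - (1 + y * I : ℂ) ^ 2) = ((y ^ 2 : ℝ) : ℂ) + ((-(2 * y) : ℝ) : ℂ) * I := by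
    push_cast
    linear_combination (-(y : ℂ) ^ 2) * I_sq
  set w : ℂ := ((y ^ 2 : ℝ) : ℂ) + ((-(2 * y) : ℝ) : ℂ) * I with hw
  have hre : w.re = y ^ 2 := by simp [hw, -ofReal_pow, -ofReal_neg, -ofReal_mul]
  have him : w.im = -(2 * y) := by simp [hw, -ofReal_pow, -ofReal_neg, -ofReal_mul]
  have hw0 : w ≠ 0 := by
    intro h
    rw [h, zero_re] at hre
    exact (pow_pos hy 2).ne hre
  have ha1 : arg w < 0 := arg_neg_iff.2 (by rw [him]; linarith)
  have ha2 : -(Real.pi / 2) < arg w :=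
    (abs_lt.1 (abs_arg_lt_pi_div_two_iff.2 (Or.inl (by rw [hre]; positivity)))).1
  have hk : poissonKernel p z (1 + y * I) =
      ((Real.exp (-(z * y)) * ‖w‖ ^ p : ℝ) : ℂ) * exp ((z + p * arg w : ℝ) * I) := by
    unfold poissonKernel
    rw [hsq, cpow_def_of_ne_zero hw0, ← exp_add, ofReal_mul, ofReal_exp,
      Real.rpow_def_of_pos (norm_pos_iff.2 hw0), ofReal_exp, ← exp_add, ← exp_add, log]
    congr 1
    push_cast
    linear_combination (z * y : ℂ) * I_mul_I
  rw [hk, im_ofReal_mul, exp_ofReal_mul_I_im, mul_left_comm]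
  have h3 : -(Real.pi * p / 2) ≤ p * arg w := by nlinarith
  have h4 : p * arg w ≤ 0 := by nlinarith
  exact mul_pos (mul_pos (Real.exp_pos _) (Real.rpow_pos_of_pos (norm_pos_iff.2 hw0) _))
    (neg_one_pow_mul_sin_pos (by linarith) (by linarith))

open Complex in
/-- Sign of the Poisson integral between the possible locations of its zeros. -/
theorem poissonBessel_sign {p z : ℝ} (hp : 0 ≤ p) (hp1 : p ≤ 1) {n : ℕ}
    (h1 : Real.pi * n + Real.pi * p / 2 < z) (h2 : z < Real.pi * (n + 1)) :
    0 < (-1) ^ n * poissonBessel p z := by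
  have hz : 0 < z := by
    have := Real.pi_pos
    have : 0 ≤ Real.pi * n + Real.pi * p / 2 := by positivity
    linarith
  have hc : Continuous fun y : ℝ => poissonKernel p z (1 + y * I) := by
    have hcp : Continuous fun y : ℝ => ((1 : ℂ) - (1 + y * I) ^ 2) ^ (p : ℂ) := by
      rcases hp.eq_or_lt with rfl | hp
      · simpa using continuous_const
      · refine continuous_iff_continuousAt.2 fun y => ?_
        refine ContinuousAt.comp (f := fun y : ℝ => (1 : ℂ) - (1 + y * I) ^ 2)
          (g := fun w : ℂ => w ^ (p : ℂ)) ?_ (by fun_prop)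
        refine continuousAt_cpow_const_of_re_pos (Or.inl ?_) (by simpa using hp)
        simp [sq]
        nlinarith [sq_nonneg y]
    unfold poissonKernel
    exact (by fun_prop : Continuous fun y : ℝ => exp (I * z * (1 + y * I))).mul hcp
  let G : ℝ → ℝ := fun y => (-1) ^ n * (poissonKernel p z (1 + y * I)).im
  have hG : Continuous G := continuous_const.mul (continuous_im.comp hc)
  have hGpos : ∀ y, 0 < y → 0 < G y := fun y hy => poissonKernel_right_sign hp h1 h2 hy
  have hGint : ∀ R : ℝ, (-1) ^ n * (∫ y in (0 : ℝ)..R, poissonKernel p z (1 + y * I)).im =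
      ∫ y in (0 : ℝ)..R, G y := fun R => by
    rw [← imCLM_apply, ← ContinuousLinearMap.intervalIntegral_comp_comm _
      (hc.intervalIntegrable _ _), ← intervalIntegral.integral_const_mul]
    rfl
  have hone : 0 < ∫ y in (0 : ℝ)..1, G y :=
    intervalIntegral.intervalIntegral_pos_of_pos_on (hG.intervalIntegrable _ _)
      (fun y hy => hGpos y hy.1) one_pos
  have hlim := ((tendsto_contour_top hp hp1 hz).const_sub (poissonBessel p z)).const_mul ((-1) ^ n)
  rw [sub_zero] at hlim
  refine hone.trans_le (ge_of_tendsto hlim ?_)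
  filter_upwards [Filter.eventually_ge_atTop 1] with R hR
  rw [poissonBessel_eq_contour hp z R, add_sub_cancel_left, hGint,
    ← intervalIntegral.integral_add_adjacent_intervals (hG.intervalIntegrable 0 1)
      (hG.intervalIntegrable 1 R)]
  have : 0 ≤ ∫ y in (1 : ℝ)..R, G y :=
    intervalIntegral.integral_nonneg hR fun y hy => (hGpos y (by linarith [hy.1])).le
  linarith

theorem exists_zero_poissonBessel {p : ℝ} (hp : 0 ≤ p) (hp1 : p ≤ 1) (n : ℕ) :
    ∃ z ∈ Icc (Real.pi * (n + 1)) (Real.pi * (n + 1) + Real.pi * p / 2), poissonBessel p z = 0 := by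
  have hc := continuous_poissonBessel hp
  have hpi := Real.pi_pos
  have hcl : ∀ m : ℕ, ∀ z ∈ Icc (Real.pi * m + Real.pi * p / 2) (Real.pi * (m + 1)),
      0 ≤ (-1) ^ m * poissonBessel p z := by
    intro m z hz
    have hcl : IsClosed {z | 0 ≤ (-1) ^ m * poissonBessel p z} :=
      isClosed_le continuous_const (continuous_const.mul hc)
    have hlt : Real.pi * m + Real.pi * p / 2 ≠ Real.pi * (m + 1) := by nlinarith
    rw [← closure_Ioo hlt] at hz
    exact closure_minimal (fun x hx => (poissonBessel_sign hp hp1 hx.1 hx.2).le) hcl hz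
  have ha := hcl n (Real.pi * (n + 1)) ⟨by nlinarith, le_rfl⟩
  have hb := hcl (n + 1) (Real.pi * (n + 1) + Real.pi * p / 2)
    ⟨by push_cast; rfl, by push_cast; nlinarith⟩
  have hab : Real.pi * (n + 1) ≤ Real.pi * (n + 1) + Real.pi * p / 2 := by
    have : 0 ≤ Real.pi * p := by positivity
    linarith
  have hivt := intermediate_value_Icc' hab
    (f := fun z => (-1) ^ n * poissonBessel p z) (continuous_const.mul hc).continuousOn
  obtain ⟨z, hz, h0⟩ := hivt ⟨by rw [pow_succ] at hb; linarith, ha⟩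
  refine ⟨z, hz, ?_⟩
  simpa using h0

/-- Two zeros of `I` at distance less than `π/2` force the first one to be a double zero. -/
theorem poissonBessel_zero_deriv {p a b : ℝ} (hp : 0 ≤ p) (ha : 0 < a) (hab : a < b)
    (hlen : b - a < Real.pi / 2) (h0a : poissonBessel p a = 0) (h0b : poissonBessel p b = 0) :
    poissonBesselDeriv p a = 0 := by
  -- Sturm comparison with `cos (z - a)`: for `y = z^(p+1) I` the function `y y' + y² tan (z - a)`
  -- is nondecreasing and vanishes at both zeros of `I`
  let N : ℝ → ℝ := fun z => poissonBessel p z * poissonBesselDeriv p z +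
    (p + 1) / z * poissonBessel p z ^ 2 + poissonBessel p z ^ 2 * Real.tan (z - a)
  let M : ℝ → ℝ := fun z => z ^ (2 * p + 2) * N z
  let M' : ℝ → ℝ := fun z => z ^ (2 * p + 2) *
    ((poissonBesselDeriv p z + ((p + 1) / z + Real.tan (z - a)) * poissonBessel p z) ^ 2 +
      p * (p + 1) / z ^ 2 * poissonBessel p z ^ 2)
  have hM : ∀ z ∈ Icc a b, HasDerivAt M (M' z) z := by
    intro z hz
    have hz0 : 0 < z := ha.trans_le hz.1
    have hcos : Real.cos (z - a) ≠ 0 :=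
      (Real.cos_pos_of_mem_Ioo ⟨by linarith [hz.1, Real.pi_pos], by linarith [hz.2]⟩).ne'
    have hI := hasDerivAt_poissonBessel hp z
    have hI' := hasDerivAt_poissonBesselDeriv hp hz0.ne'
    have htan : HasDerivAt (fun z => Real.tan (z - a)) (1 + Real.tan (z - a) ^ 2) z := by
      have := (Real.hasDerivAt_tan hcos).comp z ((hasDerivAt_id z).sub_const a)
      refine this.congr_deriv ?_
      rw [mul_one, one_div, ← Real.inv_one_add_tan_sq hcos, inv_inv]
    have hpow : HasDerivAt (fun z : ℝ => z ^ (2 * p + 2))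
        (z ^ (2 * p + 2) * ((2 * p + 2) / z)) z := by
      refine (Real.hasDerivAt_rpow_const (Or.inl hz0.ne')).congr_deriv ?_
      rw [Real.rpow_sub_one hz0.ne']
      ring
    have hinv : HasDerivAt (fun z : ℝ => (p + 1) / z) (-((p + 1) / z ^ 2)) z := by
      simpa [div_eq_mul_inv] using (hasDerivAt_inv hz0.ne').const_mul (p + 1)
    have := hpow.mul (((hI.mul hI').add (hinv.mul (hI.pow 2))).add ((hI.pow 2).mul htan))
    refine this.congr_deriv ?_
    simp only [M', Pi.mul_apply, Pi.add_apply, Pi.pow_apply]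
    field_simp
    ring
  have hM'0 : ∀ z ∈ Icc a b, 0 ≤ M' z := fun z hz => by
    have hz0 : 0 < z := ha.trans_le hz.1
    positivity
  have hmono : MonotoneOn M (Icc a b) := by
    refine monotoneOn_of_deriv_nonneg (convex_Icc _ _)
      (fun z hz => (hM z hz).continuousAt.continuousWithinAt) (fun z hz => ?_) fun z hz => ?_
    · exact (hM z (interior_subset hz)).differentiableAt.differentiableWithinAt
    · rw [(hM z (interior_subset hz)).deriv]
      exact hM'0 z (interior_subset hz)
  have hMa : M a = 0 := by simp [M, N, h0a]
  have hMb : M b = 0 := by simp [M, N, h0b]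
  have hconst : ∀ z ∈ Icc a b, M z = 0 := fun z hz => le_antisymm
    (by rw [← hMb]; exact hmono hz ⟨hab.le, le_rfl⟩ hz.2)
    (by rw [← hMa]; exact hmono ⟨le_rfl, hab.le⟩ hz hz.1)
  have ha' : a ∈ Icc a b := ⟨le_rfl, hab.le⟩
  have hd1 := (hM a ha').hasDerivWithinAt (s := Icc a b)
  have hd2 : HasDerivWithinAt M 0 (Icc a b) a :=
    (hasDerivWithinAt_const a _ 0).congr hconst hMa
  have h := (uniqueDiffOn_Icc hab a ha').eq_deriv _ hd1 hd2
  simp only [M', h0a, mul_zero, add_zero] at h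
  have := (mul_eq_zero.1 h).resolve_left (Real.rpow_pos_of_pos ha _).ne'
  simpa using this

/-- The zeros of `I` are simple: `I² + I'²` is nonincreasing on `(0, ∞)`, so a double zero would
make `I` vanish from there on, which the sign pattern excludes. -/
theorem poissonBesselDeriv_ne_zero {p a : ℝ} (hp : 0 ≤ p) (hp1 : p < 1) (ha : 0 < a)
    (h0 : poissonBessel p a = 0) : poissonBesselDeriv p a ≠ 0 := by
  intro h0'
  have hpi := Real.pi_pos
  let E : ℝ → ℝ := fun z => poissonBessel p z ^ 2 + poissonBesselDeriv p z ^ 2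
  have hE : ∀ z ∈ Ici a, HasDerivAt E (-(2 * (2 * p + 2) / z * poissonBesselDeriv p z ^ 2)) z := by
    intro z hz
    have hz0 : 0 < z := ha.trans_le hz
    have := ((hasDerivAt_poissonBessel hp z).pow 2).add
      ((hasDerivAt_poissonBesselDeriv hp hz0.ne').pow 2)
    refine this.congr_deriv ?_
    field_simp
    ring
  have hanti : AntitoneOn E (Ici a) := by
    refine antitoneOn_of_deriv_nonpos (convex_Ici a)
      (fun z hz => (hE z hz).continuousAt.continuousWithinAt) (fun z hz => ?_) fun z hz => ?_
    · exact (hE z (interior_subset hz)).differentiableAt.differentiableWithinAt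
    · have hz' := interior_subset hz
      rw [(hE z hz').deriv]
      have hz0 : 0 < z := ha.trans_le hz'
      have : 0 ≤ 2 * (2 * p + 2) / z * poissonBesselDeriv p z ^ 2 := by positivity
      linarith
  obtain ⟨n, hn⟩ := exists_nat_ge (a / Real.pi)
  rw [div_le_iff₀ hpi] at hn
  let z := Real.pi * n + Real.pi * (p / 2 + 1) / 2
  have hz1 : Real.pi * n + Real.pi * p / 2 < z := by simp only [z]; nlinarith
  have hz2 : z < Real.pi * (n + 1) := by simp only [z]; nlinarith
  have haz : a ≤ z := by
    have : 0 ≤ Real.pi * (p / 2 + 1) / 2 := by positivity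
    simp only [z]; linarith
  have h1 := hanti (mem_Ici.2 le_rfl) (mem_Ici.2 haz) haz
  simp only [E, h0, h0'] at h1
  have h2 : poissonBessel p z = 0 := by
    have := sq_nonneg (poissonBessel p z)
    have := sq_nonneg (poissonBesselDeriv p z)
    refine pow_eq_zero_iff (two_ne_zero) |>.1 (by linarith)
  have h3 := poissonBessel_sign hp hp1.le hz1 hz2
  simp [h2] at h3

/-- The nonnegative zeros of `z I(z)`: they form a strictly increasing sequence starting at `0`,
whose `n`-th term lies in `[πn, πn + πp/2]`. -/
theorem exists_zeros_poissonBessel {p : ℝ} (hp : 0 ≤ p) (hp1 : p < 1 / 2) :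
    ∃ j : ℕ → ℝ, j 0 = 0 ∧ StrictMono j ∧
      (∀ n : ℕ, j n ∈ Icc (Real.pi * n) (Real.pi * n + Real.pi * p / 2)) ∧
      ∀ z, 0 < z → (poissonBessel p z = 0 ↔ ∃ n, z = j n) := by
  have hpi := Real.pi_pos
  have hpp : 0 ≤ Real.pi * p := by positivity
  choose j₁ hj hj0 using exists_zero_poissonBessel hp (by linarith : p ≤ 1)
  let j : ℕ → ℝ := fun n => n.casesOn 0 j₁
  have hjm : ∀ n : ℕ, j n ∈ Icc (Real.pi * n) (Real.pi * n + Real.pi * p / 2) := fun n => by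
    cases n with
    | zero =>
      rw [Nat.cast_zero, mul_zero, zero_add]
      exact ⟨le_rfl, by positivity⟩
    | succ n => simpa [j] using hj n
  refine ⟨j, rfl, strictMono_nat_of_lt_succ fun n => ?_, hjm, fun z hz => ⟨fun h => ?_, ?_⟩⟩
  · have h1 := (hjm n).2
    have h2 := (hjm (n + 1)).1
    push_cast at h2
    nlinarith
  · let n := ⌊z / Real.pi⌋₊
    have hn1 : Real.pi * n ≤ z := by
      have := Nat.floor_le (div_nonneg hz.le hpi.le)
      rw [le_div_iff₀ hpi] at this
      linarith
    have hn2 : z < Real.pi * (n + 1) := by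
      have := Nat.lt_floor_add_one (z / Real.pi)
      rw [div_lt_iff₀ hpi] at this
      linarith
    have hn3 : z ≤ Real.pi * n + Real.pi * p / 2 := by
      by_contra! hlt
      have := poissonBessel_sign hp (by linarith) hlt hn2
      simp [h] at this
    refine ⟨n, ?_⟩
    rcases Nat.eq_zero_or_pos n with h0 | h0
    · rw [h0] at hn3
      have := poissonBessel_pos hp hz.le (by push_cast at hn3; nlinarith)
      exact absurd h this.ne'
    obtain ⟨m, hm⟩ := Nat.exists_eq_succ_of_ne_zero h0.ne'
    have hjn := hjm n
    have hjn0 : poissonBessel p (j n) = 0 := by rw [hm]; exact hj0 m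
    have hjpos : 0 < j n := by
      have : (1 : ℝ) ≤ n := by exact_mod_cast h0
      nlinarith [hjn.1]
    rcases lt_trichotomy z (j n) with hlt | heq | hlt
    · exfalso
      exact poissonBesselDeriv_ne_zero hp (by linarith) hz h
        (poissonBessel_zero_deriv hp hz hlt (by nlinarith [hjn.2]) h hjn0)
    · exact heq
    · exfalso
      exact poissonBesselDeriv_ne_zero hp (by linarith) hjpos hjn0
        (poissonBessel_zero_deriv hp hjpos hlt (by nlinarith [hjn.1]) hjn0 h)
  · rintro ⟨n, rfl⟩
    cases n with
    | zero => exact absurd hz (lt_irrefl _)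
    | succ n => exact hj0 n

end DegWave

/-! ### The eigenvalues of the degenerate operator -/

namespace DegWave

theorem incEnum_range {s : ℕ → ℝ} (hs : StrictMono s) (n : ℕ) : incEnum (range s) n = s n := by
  induction n with
  | zero =>
    refine IsLeast.csInf_eq ⟨mem_range_self 0, ?_⟩
    rintro _ ⟨m, rfl⟩
    exact hs.monotone (Nat.zero_le m)
  | succ n ih =>
    rw [incEnum, ih]
    refine IsLeast.csInf_eq ⟨⟨mem_range_self _, hs n.lt_succ_self⟩, ?_⟩
    rintro _ ⟨⟨m, rfl⟩, hm⟩
    exact hs.monotone (hs.lt_iff_lt.1 hm)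

theorem monotoneOn_Icc_of_hasDerivAt_nonneg {f f' : ℝ → ℝ} {a b : ℝ}
    (hc : ContinuousOn f (Icc a b)) (hd : ∀ x ∈ Ioo a b, HasDerivAt f (f' x) x)
    (h0 : ∀ x ∈ Ioo a b, 0 ≤ f' x) : MonotoneOn f (Icc a b) := by
  refine monotoneOn_of_deriv_nonneg (convex_Icc _ _) hc (fun x hx => ?_) fun x hx => ?_
  · rw [interior_Icc] at hx
    exact (hd x hx).differentiableAt.differentiableWithinAt
  · rw [interior_Icc] at hx
    rw [(hd x hx).deriv]
    exact h0 x hx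

/-- An absolutely continuous function whose derivative agrees a.e. with a function continuous on
the open interval is differentiable there in the classical sense. -/
theorem hasDerivAt_of_absolutelyContinuous {f g : ℝ → ℝ}
    (hf : AbsolutelyContinuousOnInterval f 0 1) (hg : ContinuousOn g (Ioo 0 1))
    (hfg : deriv f =ᵐ[vol 0 1] g) {x : ℝ} (hx : x ∈ Ioo (0 : ℝ) 1) : HasDerivAt f (g x) x := by
  have hsub : ∀ y ∈ Ioo (0 : ℝ) 1, uIcc x y ⊆ Ioo 0 1 := fun y hy =>
    ordConnected_Ioo.uIcc_subset hx hy
  have hint : ∀ y ∈ Ioo (0 : ℝ) 1, f y = f x + ∫ t in x..y, g t := by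
    intro y hy
    have h1 := (hf.mono (c := x) (d := y) (by
      rw [uIcc_of_le zero_le_one]
      exact (hsub y hy).trans Ioo_subset_Icc_self)).integral_deriv_eq_sub
    have h2 : ∫ t in x..y, deriv f t = ∫ t in x..y, g t := by
      refine intervalIntegral.integral_congr_ae ?_
      have := (ae_restrict_iff' measurableSet_Ioo).1 hfg
      filter_upwards [this] with t ht hxy
      exact ht (hsub y hy (uIoc_subset_uIcc hxy))
    rw [← h2, h1]
    ring
  have hnhds : Ioo (0 : ℝ) 1 ∈ nhds x := isOpen_Ioo.mem_nhds hx
  have hd : HasDerivAt (fun y => f x + ∫ t in x..y, g t) (g x) x := by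
    refine (intervalIntegral.integral_hasDerivAt_right (by simp) ?_
      (hg.continuousAt hnhds)).const_add _
    exact hg.stronglyMeasurableAtFilter isOpen_Ioo x hx
  refine hd.congr_of_eventuallyEq ?_
  filter_upwards [hnhds] with y hy using hint y hy

theorem absolutelyContinuousOnInterval_of_hasDerivAt_bounded {f f' : ℝ → ℝ} {C : ℝ}
    (hc : Continuous f) (hd : ∀ x ∈ Ioo (0 : ℝ) 1, HasDerivAt f (f' x) x)
    (hb : ∀ x ∈ Ioo (0 : ℝ) 1, |f' x| ≤ C) : AbsolutelyContinuousOnInterval f 0 1 := by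
  have hC : 0 ≤ C := (abs_nonneg _).trans (hb (1 / 2) ⟨by norm_num, by norm_num⟩)
  have h1 : LipschitzOnWith C.toNNReal f (Ioo 0 1) :=
    Convex.lipschitzOnWith_of_nnnorm_hasDerivWithin_le (convex_Ioo 0 1)
      (fun x hx => (hd x hx).hasDerivWithinAt) fun x hx => by
        rw [← NNReal.coe_le_coe, Real.coe_toNNReal C hC]
        exact hb x hx
  have h2 := h1.closure hc.continuousOn
  rw [closure_Ioo zero_ne_one, ← uIcc_of_le zero_le_one] at h2
  exact h2.absolutelyContinuousOnInterval

theorem memLp_of_bounded_on {f : ℝ → ℝ} {C : ℝ} (hf : AEStronglyMeasurable f (vol 0 1))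
    (hb : ∀ x ∈ Ioo (0 : ℝ) 1, |f x| ≤ C) : MemLp f 2 (vol 0 1) := by
  refine MemLp.of_bound hf C ?_
  filter_upwards [ae_restrict_mem measurableSet_Ioo] with x hx using hb x hx

/-- Classical regularity of an eigenpair on the open interval. -/
theorem exists_flux_of_graphA {α l : ℝ} {Φ : ℝ → ℝ} (h : GraphA α Φ fun x => -(l * Φ x)) :
    ContinuousOn Φ (Icc 0 1) ∧ ∃ w : ℝ → ℝ, ContinuousOn w (Icc 0 1) ∧ w 0 = 0 ∧ w 1 = 0 ∧
      (∀ x ∈ Ioo (0 : ℝ) 1, HasDerivAt Φ (x ^ (-α) * w x) x) ∧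
      (∀ x ∈ Ioo (0 : ℝ) 1, HasDerivAt w (-(l * Φ x)) x) := by
  obtain ⟨hΦ, w, hw, hw0, hw1, hwd⟩ := h
  have hΦc : ContinuousOn Φ (Icc 0 1) := by
    simpa [uIcc_of_le zero_le_one] using hΦ.absCont.continuousOn
  have hwc : ContinuousOn w (Icc 0 1) := by
    simpa [uIcc_of_le zero_le_one] using hw.absCont.continuousOn
  refine ⟨hΦc, w, hwc, hw0, hw1, fun x hx => ?_, fun x hx => ?_⟩
  · refine hasDerivAt_of_absolutelyContinuous (g := fun x => x ^ (-α) * w x) hΦ.absCont ?_ ?_ hx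
    · refine ContinuousOn.mul (fun y hy => ?_) (hwc.mono Ioo_subset_Icc_self)
      exact (Real.continuousAt_rpow_const y _ (Or.inl hy.1.ne')).continuousWithinAt
    · filter_upwards [hw.ae_eq, ae_restrict_mem measurableSet_Ioo] with y h1 hy
      rw [h1, ← mul_assoc, ← Real.rpow_add hy.1, neg_add_cancel, Real.rpow_zero, one_mul]
  · exact hasDerivAt_of_absolutelyContinuous (g := fun x => -(l * Φ x)) hw.absCont
      (continuousOn_const.mul (hΦc.mono Ioo_subset_Icc_self)).neg hwd hx

theorem eigenvalue_nonneg {α l : ℝ} (hl : l ∈ eigenvalues α) : 0 ≤ l := by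
  obtain ⟨Φ, hne, hG⟩ := hl
  obtain ⟨hΦc, w, hwc, hw0, hw1, hΦ, hw⟩ := exists_flux_of_graphA hG
  by_contra! hl
  refine hne ?_
  -- `Φ w` vanishes at both ends and has derivative `x^(-α) w² - l Φ² ≥ 0`
  have hd : ∀ x ∈ Ioo (0 : ℝ) 1, HasDerivAt (fun x => Φ x * w x)
      (x ^ (-α) * w x ^ 2 - l * Φ x ^ 2) x := fun x hx =>
    ((hΦ x hx).mul (hw x hx)).congr_deriv (by ring)
  have hnn : ∀ x ∈ Ioo (0 : ℝ) 1, 0 ≤ x ^ (-α) * w x ^ 2 := fun x hx =>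
    mul_nonneg (Real.rpow_nonneg hx.1.le _) (sq_nonneg _)
  have hm := monotoneOn_Icc_of_hasDerivAt_nonneg (hΦc.mul hwc) hd fun x hx => by
    nlinarith [hnn x hx, sq_nonneg (Φ x)]
  have hz : ∀ x ∈ Icc (0 : ℝ) 1, Φ x * w x = 0 := fun x hx => le_antisymm
    (by simpa [hw1] using hm hx ⟨zero_le_one, le_rfl⟩ hx.2)
    (by simpa [hw0] using hm ⟨le_rfl, zero_le_one⟩ hx hx.1)
  filter_upwards [ae_restrict_mem measurableSet_Ioo] with x hx
  have h0 : HasDerivAt (fun x => Φ x * w x) 0 x := by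
    refine (hasDerivAt_const x (0 : ℝ)).congr_of_eventuallyEq ?_
    filter_upwards [isOpen_Ioo.mem_nhds hx] with y hy using hz y (Ioo_subset_Icc_self hy)
  have := (hd x hx).unique h0
  have h2 : Φ x ^ 2 ≤ 0 := by nlinarith [hnn x hx, sq_nonneg (Φ x)]
  simpa using pow_eq_zero_iff two_ne_zero |>.1 (le_antisymm h2 (sq_nonneg _))

theorem zero_mem_eigenvalues (α : ℝ) : (0 : ℝ) ∈ eigenvalues α := by
  have hAC : ∀ c : ℝ, AbsolutelyContinuousOnInterval (fun _ : ℝ => c) 0 1 := fun c =>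
    absolutelyContinuousOnInterval_of_hasDerivAt_bounded (f' := fun _ => 0) (C := 0)
      continuous_const (fun x _ => hasDerivAt_const x c) (by simp)
  refine ⟨fun _ => 1, fun h => ?_, ⟨memLp_const _, hAC 1, by simp⟩, fun _ => 0,
    ⟨hAC 0, by simp, by simp⟩, rfl, rfl, by simp⟩
  have := Measure.eqOn_open_of_ae_eq h isOpen_Ioo continuousOn_const continuousOn_const
    (⟨by norm_num, by norm_num⟩ : (1 / 2 : ℝ) ∈ Ioo (0 : ℝ) 1)
  exact one_ne_zero this

/-- The parameter of the Poisson integral attached to `α`: the flux of the eigenfunctions is a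
Bessel function of order `p + 1/2 = 1/(2 - α)`. -/
noncomputable def besselParam (α : ℝ) : ℝ := α / (2 * (2 - α))

/-- The solution of `(x^α u')' = -l u` with vanishing flux at `0`, up to a constant factor. -/
noncomputable def regularSol (α l x : ℝ) : ℝ :=
  2 / (2 - α) * poissonBessel (besselParam α) (√l * x ^ ((2 - α) / 2) * (2 / (2 - α))) +
    √l * x ^ ((2 - α) / 2) * (2 / (2 - α)) *
      poissonBesselDeriv (besselParam α) (√l * x ^ ((2 - α) / 2) * (2 / (2 - α)))

/-- The flux `x^α u'` of `u = regularSol α l`. -/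
noncomputable def regularFlux (α l x : ℝ) : ℝ :=
  -(2 / (2 - α) * l * x *
    poissonBessel (besselParam α) (√l * x ^ ((2 - α) / 2) * (2 / (2 - α))))

theorem besselParam_nonneg {α : ℝ} (h0 : 0 ≤ α) (h1 : α < 1) : 0 ≤ besselParam α :=
  div_nonneg h0 (by linarith)

theorem besselParam_lt {α : ℝ} (h1 : α < 1) : besselParam α < 1 / 2 := by
  unfold besselParam
  rw [div_lt_div_iff₀ (by linarith) two_pos]
  linarith

theorem continuous_regularArg {α : ℝ} (h1 : α < 1) (l : ℝ) :
    Continuous fun x : ℝ => √l * x ^ ((2 - α) / 2) * (2 / (2 - α)) :=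
  (continuous_const.mul (Real.continuous_rpow_const (by linarith))).mul continuous_const

theorem continuous_regularSol {α : ℝ} (h0 : 0 ≤ α) (h1 : α < 1) (l : ℝ) :
    Continuous (regularSol α l) := by
  have hp := besselParam_nonneg h0 h1
  have hc := continuous_regularArg h1 l
  exact (continuous_const.mul ((continuous_poissonBessel hp).comp hc)).add
    (hc.mul ((continuous_poissonBesselDeriv hp).comp hc))

theorem continuous_regularFlux {α : ℝ} (h0 : 0 ≤ α) (h1 : α < 1) (l : ℝ) :
    Continuous (regularFlux α l) := by
  have hp := besselParam_nonneg h0 h1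
  have hc := continuous_regularArg h1 l
  exact ((continuous_const.mul continuous_id).mul ((continuous_poissonBessel hp).comp hc)).neg

theorem hasDerivAt_regularArg (α l : ℝ) {x : ℝ} (hx : 0 < x) :
    HasDerivAt (fun x : ℝ => √l * x ^ ((2 - α) / 2) * (2 / (2 - α)))
      (√l * x ^ ((2 - α) / 2) * (2 / (2 - α)) * ((2 - α) / 2) / x) x := by
  have := ((Real.hasDerivAt_rpow_const (p := (2 - α) / 2) (Or.inl hx.ne')).const_mul √l).mul_const
    (2 / (2 - α))
  refine this.congr_deriv ?_
  rw [Real.rpow_sub_one hx.ne']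
  ring

theorem hasDerivAt_regularSol {α : ℝ} (h0 : 0 ≤ α) (h1 : α < 1) {l : ℝ} (hl : 0 < l) {x : ℝ}
    (hx : 0 < x) : HasDerivAt (regularSol α l) (x ^ (-α) * regularFlux α l x) x := by
  have hp := besselParam_nonneg h0 h1
  have h2 : 0 < 2 - α := by linarith
  have hz := hasDerivAt_regularArg α l hx
  have hsq : (√l * x ^ ((2 - α) / 2) * (2 / (2 - α))) ^ 2 =
      l * (x ^ (-α) * x ^ 2) * (2 / (2 - α)) ^ 2 := by
    rw [mul_pow, mul_pow, Real.sq_sqrt hl.le, ← Real.rpow_natCast (x ^ _), ← Real.rpow_mul hx.le,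
      ← Real.rpow_natCast x 2, ← Real.rpow_add hx]
    congr 3
    push_cast
    ring
  have hzpos : 0 < √l * x ^ ((2 - α) / 2) * (2 / (2 - α)) := by positivity
  unfold regularSol regularFlux
  set z : ℝ → ℝ := fun x : ℝ => √l * x ^ ((2 - α) / 2) * (2 / (2 - α)) with hzdef
  change HasDerivAt (fun x => 2 / (2 - α) * poissonBessel (besselParam α) (z x) +
    z x * poissonBesselDeriv (besselParam α) (z x)) _ x
  have hI := (hasDerivAt_poissonBessel hp (z x)).comp x hz
  have hD := (hasDerivAt_poissonBesselDeriv hp hzpos.ne').comp x hz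
  refine ((hI.const_mul (2 / (2 - α))).add (hz.mul hD)).congr_deriv ?_
  change z x ^ 2 = _ at hsq
  change _ = x ^ (-α) * -(2 / (2 - α) * l * x * poissonBessel (besselParam α) (z x))
  have hxz : x ^ (-α) * l = z x ^ 2 * (2 - α) ^ 2 / (4 * x ^ 2) := by
    rw [hsq]; field_simp; ring
  rw [show x ^ (-α) * -(2 / (2 - α) * l * x * poissonBessel (besselParam α) (z x)) =
    -((x ^ (-α) * l) * (2 / (2 - α) * x * poissonBessel (besselParam α) (z x))) by ring, hxz]
  have hzx : z x ≠ 0 := hzpos.ne'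
  change 2 / (2 - α) * (poissonBesselDeriv (besselParam α) (z x) * (z x * ((2 - α) / 2) / x)) +
    (z x * ((2 - α) / 2) / x * poissonBesselDeriv (besselParam α) (z x) + z x *
      ((-((2 * besselParam α + 2) / z x * poissonBesselDeriv (besselParam α) (z x)) -
        poissonBessel (besselParam α) (z x)) * (z x * ((2 - α) / 2) / x))) = _
  have hpar : 2 * besselParam α + 2 = 2 / (2 - α) + 1 := by
    unfold besselParam; field_simp; ring
  rw [hpar]
  field_simp
  ring

theorem hasDerivAt_regularFlux {α : ℝ} (h0 : 0 ≤ α) (h1 : α < 1) (l : ℝ) {x : ℝ} (hx : 0 < x) :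
    HasDerivAt (regularFlux α l) (-(l * regularSol α l x)) x := by
  have hp := besselParam_nonneg h0 h1
  have h2 : 0 < 2 - α := by linarith
  have hI := (hasDerivAt_poissonBessel hp _).comp x (hasDerivAt_regularArg α l hx)
  refine (((hasDerivAt_id x).const_mul (2 / (2 - α) * l)).mul hI).neg.congr_deriv ?_
  simp only [Function.comp, regularSol, id]
  field_simp

theorem mem_eigenvalues_of_zero {α : ℝ} (h0 : 0 ≤ α) (h1 : α < 1) {l : ℝ} (hl : 0 < l)
    (hI : poissonBessel (besselParam α) (√l * (2 / (2 - α))) = 0) : l ∈ eigenvalues α := by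
  have hp := besselParam_nonneg h0 h1
  have hcs := continuous_regularSol h0 h1 l
  have hcf := continuous_regularFlux h0 h1 l
  obtain ⟨C, hC⟩ := isCompact_Icc.exists_bound_of_continuousOn (s := Icc (0 : ℝ) 1)
    hcs.continuousOn
  obtain ⟨K, hK⟩ := isCompact_Icc.exists_bound_of_continuousOn (s := Icc (0 : ℝ) 1)
    ((continuous_poissonBessel hp).comp (continuous_regularArg h1 l)).continuousOn
  have hds : ∀ x ∈ Ioo (0 : ℝ) 1, HasDerivAt (regularSol α l) (x ^ (-α) * regularFlux α l x) x :=
    fun x hx => hasDerivAt_regularSol h0 h1 hl hx.1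
  have hdf : ∀ x ∈ Ioo (0 : ℝ) 1, HasDerivAt (regularFlux α l) (-(l * regularSol α l x)) x :=
    fun x hx => hasDerivAt_regularFlux h0 h1 l hx.1
  -- the flux is `O(x)` at the origin, so that `x^(-α)` times it stays bounded
  have hbs : ∀ x ∈ Ioo (0 : ℝ) 1, |x ^ (-α) * regularFlux α l x| ≤ 2 / (2 - α) * l * K := by
    intro x hx
    have h2 : 0 ≤ 2 / (2 - α) * l := mul_nonneg (div_nonneg zero_le_two (by linarith)) hl.le
    have h3 : x ^ (-α) * x ≤ 1 := by
      rw [← Real.rpow_add_one hx.1.ne']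
      exact Real.rpow_le_one hx.1.le hx.2.le (by linarith)
    have h4 : 0 ≤ x ^ (-α) * x := mul_nonneg (Real.rpow_nonneg hx.1.le _) hx.1.le
    have h5 := hK x (Ioo_subset_Icc_self hx)
    rw [Real.norm_eq_abs] at h5
    have h6 : x ^ (-α) * regularFlux α l x = -((2 / (2 - α) * l) * ((x ^ (-α) * x) *
        poissonBessel (besselParam α) (√l * x ^ ((2 - α) / 2) * (2 / (2 - α))))) := by
      unfold regularFlux; ring
    rw [h6, abs_neg, abs_mul, abs_of_nonneg h2, abs_mul, abs_of_nonneg h4]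
    exact mul_le_mul_of_nonneg_left ((mul_le_of_le_one_left (abs_nonneg _) h3).trans h5) h2
  have hbf : ∀ x ∈ Ioo (0 : ℝ) 1, |-(l * regularSol α l x)| ≤ l * C := fun x hx => by
    rw [abs_neg, abs_mul, abs_of_pos hl]
    exact mul_le_mul_of_nonneg_left (hC x (Ioo_subset_Icc_self hx)) hl.le
  have hrd : deriv (regularFlux α l) =ᵐ[vol 0 1] fun x => -(l * regularSol α l x) := by
    filter_upwards [ae_restrict_mem measurableSet_Ioo] with x hx using (hdf x hx).deriv
  refine ⟨regularSol α l, fun h => ?_, ⟨?_, ?_, ?_⟩, regularFlux α l, ⟨?_, ?_, ?_⟩, ?_, ?_, hrd⟩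
  · have heq := Measure.eqOn_open_of_ae_eq h isOpen_Ioo hcs.continuousOn continuousOn_const
    have heq := heq.closure hcs continuous_const
    rw [closure_Ioo zero_ne_one] at heq
    have h3 := heq (⟨le_rfl, zero_le_one⟩ : (0 : ℝ) ∈ Icc (0 : ℝ) 1)
    have h4 : (0 : ℝ) ^ ((2 - α) / 2) = 0 := Real.zero_rpow (by linarith)
    simp only [regularSol, h4, mul_zero, zero_mul, add_zero, Pi.zero_apply] at h3
    have h5 := poissonBessel_pos hp le_rfl Real.pi_div_two_pos.le
    have h6 : 0 < 2 / (2 - α) := div_pos two_pos (by linarith)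
    exact (mul_pos h6 h5).ne' h3
  · exact memLp_of_bounded_on hcs.aestronglyMeasurable
      fun x hx => hC x (Ioo_subset_Icc_self hx)
  · exact absolutelyContinuousOnInterval_of_hasDerivAt_bounded hcs hds hbs
  · refine memLp_of_bounded_on (C := 2 / (2 - α) * l * K) ?_ fun x hx => ?_
    · exact ((Measurable.pow_const measurable_id _).mul
        (measurable_deriv _)).aestronglyMeasurable
    · rw [(hds x hx).deriv, abs_mul, abs_of_nonneg (Real.rpow_nonneg hx.1.le _)]
      exact (mul_le_of_le_one_left (abs_nonneg _)
        (Real.rpow_le_one hx.1.le hx.2.le (by linarith))).trans (hbs x hx)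
  · exact absolutelyContinuousOnInterval_of_hasDerivAt_bounded hcf hdf hbf
  · filter_upwards [ae_restrict_mem measurableSet_Ioo] with x hx
    rw [(hds x hx).deriv, ← mul_assoc, ← Real.rpow_add hx.1, add_neg_cancel, Real.rpow_zero,
      one_mul]
  · refine (memLp_congr_ae hrd).2 (memLp_of_bounded_on (C := l * C) ?_ hbf)
    exact (continuous_const.mul hcs).neg.aestronglyMeasurable
  · simp [regularFlux]
  · simp [regularFlux, hI]

theorem zero_of_mem_eigenvalues {α : ℝ} (h0 : 0 ≤ α) (h1 : α < 1) {l : ℝ} (hl : 0 < l)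
    (hmem : l ∈ eigenvalues α) :
    poissonBessel (besselParam α) (√l * (2 / (2 - α))) = 0 := by
  obtain ⟨Φ, hne, hG⟩ := hmem
  obtain ⟨hΦc, w, hwc, hw0, hw1, hΦ, hw⟩ := exists_flux_of_graphA hG
  by_contra hI
  refine hne ?_
  -- the Wronskian with the regular solution is constant and vanishes at `0`
  have hW := exists_hasDerivAt_eq_slope
    (fun x => Φ x * regularFlux α l x - w x * regularSol α l x) (fun _ => 0) zero_lt_one
    ((hΦc.mul (continuous_regularFlux h0 h1 l).continuousOn).sub
      (hwc.mul (continuous_regularSol h0 h1 l).continuousOn)) fun x hx =>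
    (((hΦ x hx).mul (hasDerivAt_regularFlux h0 h1 l hx.1)).sub
      ((hw x hx).mul (hasDerivAt_regularSol h0 h1 hl hx.1))).congr_deriv (by ring)
  have hΦ1 : Φ 1 = 0 := by
    obtain ⟨_, _, h⟩ := hW
    have h2 : (2 - α) ≠ 0 := by linarith
    simp only [hw0, hw1, regularFlux, Real.one_rpow] at h
    simpa [hl.ne', h2, hI] using h
  -- the energy `l x^α Φ² + w²` is nondecreasing and vanishes at `1`
  have hd : ∀ x ∈ Ioo (0 : ℝ) 1, HasDerivAt (fun x => l * (x ^ α * Φ x ^ 2) + w x ^ 2)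
      (l * (α * x ^ (α - 1) * Φ x ^ 2)) x := by
    intro x hx
    have h3 := (((Real.hasDerivAt_rpow_const (p := α) (Or.inl hx.1.ne')).mul
      ((hΦ x hx).pow 2)).const_mul l).add ((hw x hx).pow 2)
    refine h3.congr_deriv ?_
    have h4 : x ^ α * x ^ (-α) = 1 := by
      rw [← Real.rpow_add hx.1, add_neg_cancel, Real.rpow_zero]
    rw [Pi.pow_apply]
    push_cast
    linear_combination (2 * l * Φ x * w x) * h4
  have hm := monotoneOn_Icc_of_hasDerivAt_nonneg
    ((continuousOn_const.mul ((Real.continuous_rpow_const h0).continuousOn.mul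
      (hΦc.pow 2))).add (hwc.pow 2)) hd fun x hx => by
    have := Real.rpow_nonneg hx.1.le (α - 1)
    positivity
  filter_upwards [ae_restrict_mem measurableSet_Ioo] with x hx
  have h5 : l * (x ^ α * Φ x ^ 2) + w x ^ 2 ≤ l * ((1 : ℝ) ^ α * Φ 1 ^ 2) + w 1 ^ 2 :=
    hm (Ioo_subset_Icc_self hx) ⟨zero_le_one, le_rfl⟩ hx.2.le
  rw [hΦ1, hw1] at h5
  have h6 : 0 < x ^ α := Real.rpow_pos_of_pos hx.1 α
  have h7 : l * (x ^ α * Φ x ^ 2) ≤ 0 := by nlinarith [sq_nonneg (w x)]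
  by_contra hne
  have : 0 < Φ x ^ 2 := by
    have : Φ x ≠ 0 := hne
    positivity
  have : 0 < l * (x ^ α * Φ x ^ 2) := by positivity
  linarith

/-- The eigenvalues are `((1 - α/2) jₙ)²`, with `j₀ = 0` and `jₙ` the positive zeros of the Bessel
function of order `1/(2 - α)`, which lie within `π/4` of `πn`. -/
theorem exists_lam_eq {α : ℝ} (h0 : 0 ≤ α) (h1 : α < 1) :
    ∃ j : ℕ → ℝ, (∀ n : ℕ, j n ∈ Icc (Real.pi * n) (Real.pi * n + Real.pi * besselParam α / 2)) ∧
      ∀ n, lam α n = ((2 - α) / 2 * j n) ^ 2 := by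
  obtain ⟨j, hj0, hjm, hj, hz⟩ :=
    exists_zeros_poissonBessel (besselParam_nonneg h0 h1) (besselParam_lt h1)
  have hκ : 0 < (2 - α) / 2 := by linarith
  have hjnn : ∀ n, 0 ≤ j n := fun n => hj0 ▸ hjm.monotone (Nat.zero_le n)
  refine ⟨j, hj, fun n => ?_⟩
  have hs : StrictMono fun n => ((2 - α) / 2 * j n) ^ 2 := fun n m hnm =>
    pow_lt_pow_left₀ (mul_lt_mul_of_pos_left (hjm hnm) hκ) (mul_nonneg hκ.le (hjnn n)) two_ne_zero
  have hset : eigenvalues α = range fun n => ((2 - α) / 2 * j n) ^ 2 := by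
    ext l
    constructor
    · intro hl
      rcases (eigenvalue_nonneg hl).eq_or_lt with rfl | hpos
      · exact ⟨0, by simp [hj0]⟩
      · have h3 := zero_of_mem_eigenvalues h0 h1 hpos hl
        obtain ⟨n, hn⟩ := (hz _ (mul_pos (Real.sqrt_pos.2 hpos)
          (div_pos two_pos (by linarith)))).1 h3
        refine ⟨n, ?_⟩
        have h4 : (2 - α) ≠ 0 := by linarith
        simp only [← hn]
        rw [show (2 - α) / 2 * (√l * (2 / (2 - α))) = √l by field_simp, Real.sq_sqrt hpos.le]
    · rintro ⟨n, rfl⟩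
      rcases (hjnn n).eq_or_lt with h | hpos
      · simpa [← h] using zero_mem_eigenvalues α
      · have h4 : (2 - α) ≠ 0 := by linarith
        refine mem_eigenvalues_of_zero h0 h1 (by positivity) ?_
        rw [Real.sqrt_sq (by positivity),
          show (2 - α) / 2 * j n * (2 / (2 - α)) = j n by field_simp]
        exact (hz _ hpos).2 ⟨n, rfl⟩
  rw [lam, hset, incEnum_range hs]

end DegWave

theorem lemma7p1 (α : ℝ) (h0 : 0 ≤ α) (h1 : α < 1) :
    DegWave.IsRieszBasis
      (fun n : ℤ => DegWave.expL2 (DegWave.T0 α) (DegWave.omega α n)) := by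
  obtain ⟨j, hj, hlam⟩ := DegWave.exists_lam_eq h0 h1
  have h2 : 0 < 2 - α := by linarith
  have hpi := Real.pi_pos
  have hjnn : ∀ n, 0 ≤ j n := fun n => le_trans (by positivity) (hj n).1
  have hsqrt : ∀ n, √(DegWave.lam α n) = (2 - α) / 2 * j n := fun n => by
    rw [hlam, Real.sqrt_sq (mul_nonneg (by linarith) (hjnn n))]
  have hp := DegWave.besselParam_nonneg h0 h1
  have hp' := DegWave.besselParam_lt h1
  refine DegWave.isRieszBasis_expL2 (T := DegWave.T0 α) (Θ := Real.pi * DegWave.besselParam α / 2)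
    (div_pos four_pos h2) (by nlinarith) _ fun n => ?_
  have key : ∀ m : ℕ, |(2 - α) / 2 * j m - 2 * Real.pi * m / DegWave.T0 α| * DegWave.T0 α ≤
      2 * (Real.pi * DegWave.besselParam α / 2) := fun m => by
    have h3 : (2 - α) / 2 * j m - 2 * Real.pi * m / DegWave.T0 α =
        (2 - α) / 2 * (j m - Real.pi * m) := by
      unfold DegWave.T0; field_simp; ring
    rw [h3, abs_of_nonneg (mul_nonneg (by linarith) (by linarith [(hj m).1])),
      show (2 - α) / 2 * (j m - Real.pi * m) * DegWave.T0 α = 2 * (j m - Real.pi * m) by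
        unfold DegWave.T0; field_simp; ring]
    linarith [(hj m).2]
  unfold DegWave.omega
  rcases lt_trichotomy n 0 with hn | rfl | hn
  · rw [if_pos hn, hsqrt]
    have hc : (n : ℝ) = -(n.natAbs : ℝ) := by
      rw [Nat.cast_natAbs, abs_of_neg hn]; push_cast; ring
    have := key n.natAbs
    rw [hc, ← abs_neg]
    rwa [show -(-((2 - α) / 2 * j n.natAbs) - 2 * Real.pi * -(n.natAbs : ℝ) / DegWave.T0 α) =
      (2 - α) / 2 * j n.natAbs - 2 * Real.pi * n.natAbs / DegWave.T0 α by ring]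
  · simp
    positivity
  · rw [if_neg hn.not_gt, if_neg hn.ne', hsqrt]
    have hc : (n : ℝ) = (n.natAbs : ℝ) := by rw [Nat.cast_natAbs, abs_of_pos hn]
    rw [hc]
    exact key n.natAbs
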